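/- Let $(B^{2n+1},\phi,\xi,\eta,g)$ be a Sasakian manifold with Levi-Civita connection $\nabla$. That is: $g$ is a Riemannian metric; $\eta(\xi)=1$, $d\eta(\xi,\cdot)=0$, $\phi^2=-I+\eta\otimes\xi$ and $g(X,Y)=g(\phi X,\phi Y)+\eta(X)\eta(Y)$; $g(\phi X,Y)=-d\eta(X,Y)$, where $d\eta(X,Y)=\tfrac12\bigl(X\eta(Y)-Y\eta(X)-\eta([X,Y])\bigr)$; $\xi$ is a Killing field; and $(\nabla_X\phi)Y=g(X,Y)\xi-\eta(Y)X$. Let $\mathcal D=\xi^\perp$, let $p$ be the orthogonal projection onto $\mathcal D$, and let $\nabla^{\mathcal D}$ be the covariant derivative on $\mathcal D$ with $\nabla^{\mathcal D}_\xi Y=p([\xi,Y])$ and $\nabla^{\mathcal D}_XY=p(\nabla_XY)$ for $X\perp\xi$; write $R^{\mathcal D}$ for its curvature. Let $\pi:P\to B$ be a smooth principal $S^1$-bundle with a flat connection form $A_0:TP\to i\mathbb R$. Put $A=A_0+i\,\pi^*\eta$, which is again a connection form, and let $D$ be the Levi-Civita connection of the Kaluza-Klein (Lorentzian) metric $\tilde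 g=\pi^*g+A\otimes A$ on $P$. Let $R(U,V)W=D_UD_VW-D_VD_UW-D_{[U,V]}W$ be the curvature of $D$. Let $v$ be the vertical vector field on $P$ with $A(v)=i$, and for a vector field $X$ on $B$ let $\hat X$ be its $A$-horizontal lift, i.e. $A(\hat X)=0$ and $T\pi(\hat X)=X$. Put $r=\hat\xi+v$ and $\tilde r=\hat\xi-v$. Then for all smooth sections $X,Y,Z$ of $\mathcal D$: \begin{align*} R(\cdot,\cdot)r&=0, & R(r,\cdot)&=0, & R(\hat X,\hat Y)\hat Z&=\widehat{R^{\mathcal D}(X,Y)Z},\\ R(\hat X,\hat Y)\tilde r&=0, & R(\hat X,v)\hat Y&=g(X,Y)\,r, & R(\hat X,v)\tilde r&=-2\hat X. \end{align*} -/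

import Mathlib

open scoped Manifold ContDiff

namespace KaluzaKlein

/-! ### Connections, Levi-Civita connections and curvature -/

section Connections

variable {m : ℕ} {M : Type*} [TopologicalSpace M] [ChartedSpace (EuclideanSpace ℝ (Fin m)) M]

/-- A (not necessarily smooth) vector field on an `m`-dimensional manifold. -/
abbrev VField (m : ℕ) (M : Type*) [TopologicalSpace M]
    [ChartedSpace (EuclideanSpace ℝ (Fin m)) M] : Type _ :=
  Π x : M, TangentSpace (𝓡 m) x

/-- A vector field is smooth if it is smooth as a map into the tangent bundle. -/
def IsSmoothField [IsManifold (𝓡 m) ∞ M] (X : VField m M) : Prop :=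
  ContMDiff (𝓡 m) (𝓡 m).tangent ∞ (fun x : M => (⟨x, X x⟩ : TangentBundle (𝓡 m) M))

/-- The Lie bracket of two vector fields. -/
noncomputable abbrev bracket (X Y : VField m M) : VField m M :=
  VectorField.mlieBracket (𝓡 m) X Y

/-- The derivative `X(f)` of a real function along a vector field. -/
noncomputable def fieldDeriv (X : VField m M) (f : M → ℝ) : M → ℝ :=
  fun x => mfderiv (𝓡 m) 𝓘(ℝ, ℝ) f x (X x)

/-- Covariant derivatives on the tangent bundle. -/
abbrev TangentConnection (m : ℕ) (M : Type*) [TopologicalSpace M]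
    [ChartedSpace (EuclideanSpace ℝ (Fin m)) M] [IsManifold (𝓡 m) ∞ M] : Type _ :=
  CovariantDerivative (𝓡 m) (EuclideanSpace ℝ (Fin m))
    (TangentSpace (𝓡 m) : M → Type _)

variable [IsManifold (𝓡 m) ∞ M]

/-- `D_X Y`. -/
noncomputable def covDeriv (D : TangentConnection m M) (X Y : VField m M) : VField m M :=
  fun x => D Y x (X x)

/-- The curvature `R(X, Y) Z = D_X D_Y Z - D_Y D_X Z - D_[X,Y] Z`. -/
noncomputable def curvature (D : TangentConnection m M) (X Y Z : VField m M) : VField m M :=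
  covDeriv D X (covDeriv D Y Z) - covDeriv D Y (covDeriv D X Z) - covDeriv D (bracket X Y) Z

/-- `D` is a Levi-Civita connection of the field `h` of bilinear forms: it is smooth (it maps smooth
fields to smooth fields), torsion-free, and `u (h(Y, Z)) = h(D_u Y, Z) + h(Y, D_u Z)`. -/
structure IsLeviCivita (h : Π x : M, TangentSpace (𝓡 m) x → TangentSpace (𝓡 m) x → ℝ)
    (D : TangentConnection m M) : Prop where
  smooth : CovariantDerivative.ContMDiffCovariantDerivative D ∞
  torsion_free : D.torsion = 0
  metric : ∀ (x : M) (u : TangentSpace (𝓡 m) x) (Y Z : VField m M),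
    MDifferentiableAt (𝓡 m) (𝓡 m).tangent (fun y : M => (⟨y, Y y⟩ : TangentBundle (𝓡 m) M)) x →
    MDifferentiableAt (𝓡 m) (𝓡 m).tangent (fun y : M => (⟨y, Z y⟩ : TangentBundle (𝓡 m) M)) x →
      (mfderiv (𝓡 m) 𝓘(ℝ, ℝ) (fun y => h y (Y y) (Z y)) x u : ℝ) =
        h x (D Y x u) (Z x) + h x (Y x) (D Z x u)

/-- The orthogonal projection of `X` onto `ξ^⊥`, for a field `ξ` with `h(ξ, ξ) ≠ 0`. -/
noncomputable def orthProj (h : Π x : M, TangentSpace (𝓡 m) x → TangentSpace (𝓡 m) x → ℝ)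
    (ξ X : VField m M) : VField m M :=
  fun x => X x - (h x (X x) (ξ x) / h x (ξ x) (ξ x)) • ξ x

/-- The transverse covariant derivative `∇^𝒟_X Y` of a section `Y` of `𝒟 = ξ^⊥`. It is given by
`p(∇_X Y)` for `X` orthogonal to `ξ`, and by `p([ξ, Y])` for `X = ξ`; a general `X` is decomposed
as `p(X) + (h(X, ξ) / h(ξ, ξ)) ξ`. -/
noncomputable def transverseDeriv
    (h : Π x : M, TangentSpace (𝓡 m) x → TangentSpace (𝓡 m) x → ℝ)
    (D : TangentConnection m M) (ξ X Y : VField m M) : VField m M :=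
  fun x => orthProj h ξ (covDeriv D (orthProj h ξ X) Y) x +
    (h x (X x) (ξ x) / h x (ξ x) (ξ x)) • orthProj h ξ (bracket ξ Y) x

/-- The curvature `R^𝒟(X, Y) Z` of the transverse covariant derivative, `Z` a section of `ξ^⊥`. -/
noncomputable def transverseCurvature
    (h : Π x : M, TangentSpace (𝓡 m) x → TangentSpace (𝓡 m) x → ℝ)
    (D : TangentConnection m M) (ξ X Y Z : VField m M) : VField m M :=
  transverseDeriv h D ξ X (transverseDeriv h D ξ Y Z)
    - transverseDeriv h D ξ Y (transverseDeriv h D ξ X Z)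
    - transverseDeriv h D ξ (bracket X Y) Z

end Connections

/-! ### One-forms and Sasakian structures -/

section Sasakian

/-- A smooth real-valued 1-form: a smooth fibrewise linear function on the tangent bundle. -/
structure OneForm (m : ℕ) (M : Type*) [TopologicalSpace M]
    [ChartedSpace (EuclideanSpace ℝ (Fin m)) M] [IsManifold (𝓡 m) ∞ M] where
  toFun : Π x : M, TangentSpace (𝓡 m) x →L[ℝ] ℝ
  smooth : ContMDiff (𝓡 m).tangent 𝓘(ℝ, ℝ) ∞
    (fun u : TangentBundle (𝓡 m) M => toFun u.proj u.2)

/-- The exterior derivative of a 1-form, with the normalization customary in contact metric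
geometry: `dη(X, Y) = 1/2 (X(η(Y)) - Y(η(X)) - η([X, Y]))`. -/
noncomputable def OneForm.d {m : ℕ} {M : Type*} [TopologicalSpace M]
    [ChartedSpace (EuclideanSpace ℝ (Fin m)) M] [IsManifold (𝓡 m) ∞ M]
    (η : OneForm m M) (X Y : VField m M) : M → ℝ :=
  fun x => (1 / 2) * (fieldDeriv X (fun y => η.toFun y (Y y)) x
    - fieldDeriv Y (fun y => η.toFun y (X y)) x - η.toFun x (bracket X Y x))

/-- An almost contact metric structure `(φ, ξ, η, g)`, with the condition `dη(ξ, ·) = 0`. -/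
structure AlmostContactMetric (m : ℕ) (M : Type*) [TopologicalSpace M]
    [ChartedSpace (EuclideanSpace ℝ (Fin m)) M] [IsManifold (𝓡 m) ∞ M] where
  φ : Π x : M, TangentSpace (𝓡 m) x →L[ℝ] TangentSpace (𝓡 m) x
  φ_smooth : ContMDiff (𝓡 m).tangent (𝓡 m).tangent ∞
    (fun u : TangentBundle (𝓡 m) M => (⟨u.proj, φ u.proj u.2⟩ : TangentBundle (𝓡 m) M))
  ξ : VField m M
  ξ_smooth : IsSmoothField ξ
  η : OneForm m M
  riem : Bundle.ContMDiffRiemannianMetric (𝓡 m) ∞ (EuclideanSpace ℝ (Fin m))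
    (TangentSpace (𝓡 m) : M → Type _)
  η_ξ : ∀ x, η.toFun x (ξ x) = 1
  dη_ξ : ∀ X : VField m M, IsSmoothField X → ∀ x, η.d ξ X x = 0
  φ_φ : ∀ x u, φ x (φ x u) = -u + η.toFun x u • ξ x
  riem_eq : ∀ x u w,
    riem.inner x u w = riem.inner x (φ x u) (φ x w) + η.toFun x u * η.toFun x w

variable {m : ℕ} {M : Type*} [TopologicalSpace M] [ChartedSpace (EuclideanSpace ℝ (Fin m)) M]
  [IsManifold (𝓡 m) ∞ M]

/-- The Riemannian metric, as a field of bilinear forms. -/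
noncomputable def AlmostContactMetric.g (S : AlmostContactMetric m M) :
    Π x : M, TangentSpace (𝓡 m) x → TangentSpace (𝓡 m) x → ℝ :=
  fun x u w => S.riem.inner x u w

/-- `ξ` is a Killing field of `h`: the Lie derivative of `h` along `ξ` vanishes. -/
def IsKilling (h : Π x : M, TangentSpace (𝓡 m) x → TangentSpace (𝓡 m) x → ℝ)
    (ξ : VField m M) : Prop :=
  ∀ X Y : VField m M, IsSmoothField X → IsSmoothField Y → ∀ x,
    fieldDeriv ξ (fun y => h y (X y) (Y y)) x - h x (bracket ξ X x) (Y x)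
      - h x (X x) (bracket ξ Y x) = 0

/-- K-contact structures. -/
structure AlmostContactMetric.IsKContact (S : AlmostContactMetric m M) : Prop where
  contact : ∀ X Y : VField m M, IsSmoothField X → IsSmoothField Y → ∀ x,
    S.g x (S.φ x (X x)) (Y x) = -S.η.d X Y x
  killing : IsKilling S.g S.ξ

/-- Sasakian structures: K-contact structures with `(∇_X φ)(Y) = g(X, Y) ξ - η(Y) X`, where `∇`
stands for the Levi-Civita connection of the metric. -/
structure AlmostContactMetric.IsSasakian (S : AlmostContactMetric m M)
    (nabla : TangentConnection m M) : Prop where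
  kContact : S.IsKContact
  nabla_φ : ∀ X Y : VField m M, IsSmoothField X → IsSmoothField Y → ∀ x,
    covDeriv nabla X (fun y => S.φ y (Y y)) x - S.φ x (covDeriv nabla X Y x) =
      S.g x (X x) (Y x) • S.ξ x - S.η.toFun x (Y x) • X x

end Sasakian

/-! ### Principal circle bundles, connection forms and Kaluza-Klein metrics -/

section Bundles

/-- A principal circle bundle `π : P → B` over an `m`-dimensional manifold: a smooth action of the
circle on `P` along the fibres of `π`, and equivariant smooth local trivializations
`π⁻¹(U) ≃ U × S¹`. (The circle is commutative, so left and right actions are the same.) -/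
structure PrincipalCircleBundle (m : ℕ) (B P : Type*)
    [TopologicalSpace B] [ChartedSpace (EuclideanSpace ℝ (Fin m)) B] [IsManifold (𝓡 m) ∞ B]
    [TopologicalSpace P] [ChartedSpace (EuclideanSpace ℝ (Fin (m + 1))) P]
    [IsManifold (𝓡 (m + 1)) ∞ P] [MulAction Circle P] where
  proj : P → B
  proj_smooth : ContMDiff (𝓡 (m + 1)) (𝓡 m) ∞ proj
  smul_smooth : ContMDiff ((𝓡 1).prod (𝓡 (m + 1))) (𝓡 (m + 1)) ∞
    (fun q : Circle × P => q.1 • q.2)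
  proj_smul : ∀ (z : Circle) (p : P), proj (z • p) = proj p
  exists_trivialization : ∀ b : B, ∃ (U : Set B) (e : OpenPartialHomeomorph P (B × Circle)),
    IsOpen U ∧ b ∈ U ∧ e.source = proj ⁻¹' U ∧ e.target = U ×ˢ Set.univ ∧
    ContMDiffOn (𝓡 (m + 1)) ((𝓡 m).prod (𝓡 1)) ∞ e e.source ∧
    ContMDiffOn ((𝓡 m).prod (𝓡 1)) (𝓡 (m + 1)) ∞ e.symm e.target ∧
    (∀ p ∈ e.source, (e p).1 = proj p) ∧
    ∀ (z : Circle), ∀ p ∈ e.source, (e (z • p)).2 = z * (e p).2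

variable {m : ℕ} {B P : Type*}
  [TopologicalSpace B] [ChartedSpace (EuclideanSpace ℝ (Fin m)) B] [IsManifold (𝓡 m) ∞ B]
  [TopologicalSpace P] [ChartedSpace (EuclideanSpace ℝ (Fin (m + 1))) P]
  [IsManifold (𝓡 (m + 1)) ∞ P] [MulAction Circle P]

namespace PrincipalCircleBundle

variable (π : PrincipalCircleBundle m B P)

/-- The differential of the projection. -/
noncomputable def dproj (p : P) :
    TangentSpace (𝓡 (m + 1)) p →L[ℝ] TangentSpace (𝓡 m) (π.proj p) :=
  mfderiv (𝓡 (m + 1)) (𝓡 m) π.proj p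

/-- The vertical field `v`, `v(p) = d/dt|_{t = 0} (p · exp(i t))`. By the normalization of
connection forms, it is the vertical field on which they are equal to `i`. -/
noncomputable def vert (_π : PrincipalCircleBundle m B P) : VField (m + 1) P :=
  fun p => (mfderiv 𝓘(ℝ, ℝ) (𝓡 (m + 1)) (fun t : ℝ => Circle.exp t • p) 0 (1 : ℝ) :
    EuclideanSpace ℝ (Fin (m + 1)))

/-- A connection form, with values in `𝔲(1) = iℝ ⊆ ℂ`: a smooth 1-form that is invariant under the
circle action and takes the value `i` on the fundamental vector field of `i`. -/
structure ConnectionForm (π : PrincipalCircleBundle m B P) where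
  toFun : Π p : P, TangentSpace (𝓡 (m + 1)) p →L[ℝ] ℂ
  re_eq_zero : ∀ p u, (toFun p u).re = 0
  smooth : ContMDiff (𝓡 (m + 1)).tangent 𝓘(ℝ, ℂ) ∞
    (fun u : TangentBundle (𝓡 (m + 1)) P => toFun u.proj u.2)
  invariant : ∀ (z : Circle) (p : P) (u : TangentSpace (𝓡 (m + 1)) p),
    toFun (z • p) (mfderiv (𝓡 (m + 1)) (𝓡 (m + 1)) (fun q : P => z • q) p u) = toFun p u
  vert_eq : ∀ p, toFun p (π.vert p) = Complex.I

theorem dproj_vert (p : P) : π.dproj p (π.vert p) = 0 := by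
  have hsm : MDifferentiableAt 𝓘(ℝ, ℝ) (𝓡 (m + 1)) (fun t : ℝ => Circle.exp t • p) 0 := by
    have h1 : ContMDiff 𝓘(ℝ, ℝ) ((𝓡 1).prod (𝓡 (m + 1))) ∞
        (fun t : ℝ => ((Circle.exp t, p) : Circle × P)) :=
      contMDiff_circleExp.prodMk contMDiff_const
    exact (π.smul_smooth.comp h1).mdifferentiable (by simp) 0
  have hp : (fun t : ℝ => Circle.exp t • p) 0 = p := by simp
  have hpr : MDifferentiableAt (𝓡 (m + 1)) (𝓡 m) π.proj
      ((fun t : ℝ => Circle.exp t • p) 0) := π.proj_smooth.mdifferentiable (by simp) _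
  have hc := mfderiv_comp (0 : ℝ) hpr hsm
  have hconst : (π.proj ∘ fun t : ℝ => Circle.exp t • p) = fun _ => π.proj p := by
    funext t; exact π.proj_smul _ _
  have h0 := congrArg (fun L => L (1 : ℝ)) hc
  rw [hconst, mfderiv_const] at h0
  have key : ∀ q : P, q = p →
      (mfderiv (𝓡 (m + 1)) (𝓡 m) π.proj q : EuclideanSpace ℝ (Fin (m + 1)) →L[ℝ]
        EuclideanSpace ℝ (Fin m)) = mfderiv (𝓡 (m + 1)) (𝓡 m) π.proj p := by
    rintro q rfl; rfl
  have h1 := key (Circle.exp 0 • p) hp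
  have h2 := DFunLike.congr_fun h1 (π.vert p : EuclideanSpace ℝ (Fin (m + 1)))
  exact h2.symm.trans h0.symm

theorem dproj_smul (z : Circle) (p : P) (u : TangentSpace (𝓡 (m + 1)) p) :
    (π.dproj (z • p) (mfderiv (𝓡 (m + 1)) (𝓡 (m + 1)) (fun q : P => z • q) p u) :
      EuclideanSpace ℝ (Fin m)) = π.dproj p u := by
  have hsm : MDifferentiableAt (𝓡 (m + 1)) (𝓡 (m + 1)) (fun q : P => z • q) p := by
    have h1 : ContMDiff (𝓡 (m + 1)) ((𝓡 1).prod (𝓡 (m + 1))) ∞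
        (fun q : P => ((z, q) : Circle × P)) := contMDiff_const.prodMk contMDiff_id
    exact (π.smul_smooth.comp h1).mdifferentiable (by simp) p
  have hpr : MDifferentiableAt (𝓡 (m + 1)) (𝓡 m) π.proj ((fun q : P => z • q) p) :=
    π.proj_smooth.mdifferentiable (by simp) _
  have hc := mfderiv_comp p hpr hsm
  have hconst : (π.proj ∘ fun q : P => z • q) = π.proj := by
    funext q; exact π.proj_smul _ _
  rw [hconst] at hc
  exact (congrArg (fun L => L u) hc).symm

theorem dproj_surjective (p : P) : Function.Surjective (π.dproj p) := by
  intro w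
  obtain ⟨U, e, hU, hb, hs, ht, -, he', hfst, -⟩ := π.exists_trivialization (π.proj p)
  have hpe : p ∈ e.source := by rw [hs]; exact hb
  have hep : e p = (π.proj p, (e p).2) := Prod.ext (hfst p hpe) rfl
  set s : B → P := fun b => e.symm (b, (e p).2) with hsdef
  have hsp : s (π.proj p) = p := by
    have h3 : e.symm (e p) = p := e.left_inv hpe
    rw [hep] at h3
    exact h3
  have hmem : ((π.proj p, (e p).2) : B × Circle) ∈ e.target := by
    rw [ht]; exact ⟨hb, trivial⟩
  have hsd : MDifferentiableAt (𝓡 m) (𝓡 (m + 1)) s (π.proj p) := by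
    have h1 : ContMDiffAt ((𝓡 m).prod (𝓡 1)) (𝓡 (m + 1)) ∞ e.symm (π.proj p, (e p).2) :=
      he'.contMDiffAt (e.open_target.mem_nhds hmem)
    have h2 : ContMDiffAt (𝓡 m) ((𝓡 m).prod (𝓡 1)) ∞
        (fun b : B => ((b, (e p).2) : B × Circle)) (π.proj p) :=
      contMDiffAt_id.prodMk contMDiffAt_const
    exact (ContMDiffAt.comp (π.proj p) h1 h2).mdifferentiableAt (by simp)
  have hpr : MDifferentiableAt (𝓡 (m + 1)) (𝓡 m) π.proj (s (π.proj p)) :=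
    π.proj_smooth.mdifferentiable (by simp) _
  have hc := mfderiv_comp (π.proj p) hpr hsd
  have hid : (π.proj ∘ s) =ᶠ[nhds (π.proj p)] id := by
    filter_upwards [hU.mem_nhds hb] with b hbU
    have hbt : ((b, (e p).2) : B × Circle) ∈ e.target := by rw [ht]; exact ⟨hbU, trivial⟩
    have h4 := hfst _ (e.map_target hbt)
    rw [e.right_inv hbt] at h4
    exact h4.symm
  rw [hid.mfderiv_eq, mfderiv_id] at hc
  have key : ∀ q : P, q = p →
      (mfderiv (𝓡 (m + 1)) (𝓡 m) π.proj q : EuclideanSpace ℝ (Fin (m + 1)) →L[ℝ]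
        EuclideanSpace ℝ (Fin m)) = mfderiv (𝓡 (m + 1)) (𝓡 m) π.proj p := by
    rintro q rfl; rfl
  refine ⟨(mfderiv (𝓡 m) (𝓡 (m + 1)) s (π.proj p) w : EuclideanSpace ℝ (Fin (m + 1))), ?_⟩
  have h1 := key (s (π.proj p)) hsp
  have h2 := DFunLike.congr_fun h1 (mfderiv (𝓡 m) (𝓡 (m + 1)) s (π.proj p) w :
    EuclideanSpace ℝ (Fin (m + 1)))
  exact h2.symm.trans (congrArg (fun L => L w) hc).symm

variable {π}

/-- A tangent vector of the base has exactly one horizontal lift at every point above. -/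
theorem ConnectionForm.existsUnique_lift (A : π.ConnectionForm) (p : P)
    (w : TangentSpace (𝓡 m) (π.proj p)) :
    ∃! u : TangentSpace (𝓡 (m + 1)) p, A.toFun p u = 0 ∧ π.dproj p u = w := by
  obtain ⟨u₀, hu₀⟩ := π.dproj_surjective p w
  refine ⟨u₀ - (A.toFun p u₀).im • π.vert p, ⟨?_, ?_⟩, ?_⟩
  · rw [map_sub, map_smul, A.vert_eq]
    apply Complex.ext <;> simp [A.re_eq_zero]
  · rw [map_sub, map_smul, π.dproj_vert, smul_zero, sub_zero, hu₀]
  · rintro u ⟨hu, hu'⟩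
    have hker : Module.finrank ℝ (LinearMap.ker (π.dproj p).toLinearMap) = 1 := by
      have : FiniteDimensional ℝ (TangentSpace (𝓡 (m + 1)) p) :=
        inferInstanceAs (FiniteDimensional ℝ (EuclideanSpace ℝ (Fin (m + 1))))
      have h1 := LinearMap.finrank_range_add_finrank_ker (π.dproj p).toLinearMap
      have h2 : LinearMap.range (π.dproj p).toLinearMap = ⊤ :=
        LinearMap.range_eq_top.2 (π.dproj_surjective p)
      rw [h2, finrank_top] at h1
      have h3 : Module.finrank ℝ (TangentSpace (𝓡 m) (π.proj p)) = m :=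
        finrank_euclideanSpace_fin (𝕜 := ℝ)
      have h4 : Module.finrank ℝ (TangentSpace (𝓡 (m + 1)) p) = m + 1 :=
        finrank_euclideanSpace_fin (𝕜 := ℝ)
      omega
    have hv : (⟨π.vert p, π.dproj_vert p⟩ : LinearMap.ker (π.dproj p).toLinearMap) ≠ 0 := by
      intro h
      have h5 : π.vert p = 0 := congrArg Subtype.val h
      have h6 := A.vert_eq p
      rw [h5, map_zero] at h6
      exact Complex.I_ne_zero h6.symm
    have hu'' : u - u₀ ∈ LinearMap.ker (π.dproj p).toLinearMap := by
      change π.dproj p (u - u₀) = 0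
      rw [map_sub, hu', hu₀, sub_self]
    obtain ⟨c, hc⟩ := (finrank_eq_one_iff_of_nonzero' _ hv).1 hker ⟨u - u₀, hu''⟩
    have hc' : c • π.vert p = u - u₀ := congrArg Subtype.val hc
    have h7 := congrArg (fun x => (A.toFun p x).im) hc'
    simp only [map_smul, map_sub, A.vert_eq, hu] at h7
    have h8 : c = -(A.toFun p u₀).im := by simpa using h7
    rw [sub_eq_add_neg, ← neg_smul, ← h8, hc']
    abel

/-- The horizontal lift of a vector field `X` on the base: the unique vector field on `P` that is
annihilated by `A` and projects to `X`. -/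
noncomputable def ConnectionForm.lift (A : π.ConnectionForm) (X : VField m B) :
    VField (m + 1) P :=
  fun p => (A.existsUnique_lift p (X (π.proj p))).choose

theorem ConnectionForm.lift_spec (A : π.ConnectionForm) (X : VField m B) (p : P) :
    A.toFun p (A.lift X p) = 0 ∧ π.dproj p (A.lift X p) = X (π.proj p) :=
  (A.existsUnique_lift p (X (π.proj p))).choose_spec.1

/-- The curvature form `Ω(X, Y) = -A([X̂, Ŷ])`, where `X̂`, `Ŷ` are the horizontal lifts. -/
noncomputable def ConnectionForm.curvatureForm (A : π.ConnectionForm) (X Y : VField m B) : P → ℂ :=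
  fun p => -A.toFun p (bracket (A.lift X) (A.lift Y) p)

/-- A connection form is flat if its curvature form vanishes. -/
def ConnectionForm.IsFlat (A : π.ConnectionForm) : Prop :=
  ∀ X Y : VField m B, IsSmoothField X → IsSmoothField Y → ∀ p, A.curvatureForm X Y p = 0

/-- The connection form `A + i π^*θ`, for a 1-form `θ` on the base. -/
noncomputable def ConnectionForm.addPullback (A : π.ConnectionForm) (θ : OneForm m B) :
    π.ConnectionForm where
  toFun p := A.toFun p +
    (Complex.I • Complex.ofRealCLM).comp ((θ.toFun (π.proj p)).comp (π.dproj p))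
  re_eq_zero p u := by
    simp [A.re_eq_zero]
  smooth := by
    have h1 : ContMDiff (𝓡 (m + 1)).tangent (𝓡 m).tangent ∞ (tangentMap (𝓡 (m + 1)) (𝓡 m) π.proj) :=
      π.proj_smooth.contMDiff_tangentMap (by simp)
    have h2 := θ.smooth.comp h1
    have h3 : ContMDiff 𝓘(ℝ, ℝ) 𝓘(ℝ, ℂ) ∞ (Complex.I • Complex.ofRealCLM) :=
      ContinuousLinearMap.contMDiff _
    exact A.smooth.add (h3.comp h2)
  invariant z p u := by
    have key : ∀ b b' : B, b = b' → ∀ w : EuclideanSpace ℝ (Fin m),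
        θ.toFun b w = θ.toFun b' w := by
      rintro b _ rfl w; rfl
    have h1 := key _ _ (π.proj_smul z p) (π.dproj (z • p)
      (mfderiv (𝓡 (m + 1)) (𝓡 (m + 1)) (fun q : P => z • q) p u))
    have h2 : θ.toFun (π.proj (z • p)) (π.dproj (z • p)
        (mfderiv (𝓡 (m + 1)) (𝓡 (m + 1)) (fun q : P => z • q) p u)) =
        θ.toFun (π.proj p) (π.dproj p u) :=
      h1.trans (congrArg (fun w : EuclideanSpace ℝ (Fin m) => θ.toFun (π.proj p) w)
        (π.dproj_smul z p u))
    have h3 := A.invariant z p u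
    simp only [add_apply, ContinuousLinearMap.comp_apply]
    rw [h3, h2]
  vert_eq p := by
    simp [A.vert_eq, π.dproj_vert]

/-- The Kaluza-Klein metric `π^*h + σ A ⊗ A`. The product of two values of `A` is real. -/
noncomputable def ConnectionForm.kkMetric (A : π.ConnectionForm)
    (h : Π x : B, TangentSpace (𝓡 m) x → TangentSpace (𝓡 m) x → ℝ) (σ : ℝ) :
    Π p : P, TangentSpace (𝓡 (m + 1)) p → TangentSpace (𝓡 (m + 1)) p → ℝ :=
  fun p u w => h (π.proj p) (π.dproj p u) (π.dproj p w) +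
    σ * (A.toFun p u * A.toFun p w).re

end PrincipalCircleBundle

end Bundles

end KaluzaKlein

/-! Write `A = i α`, so that the metric on `P` is `π^*g - α ⊗ α`, with `α(v) = 1`. Since `A₀` is
flat, the vertical part of `[X̂, Ŷ]` is `-2 dη(X, Y) = 2 g(φX, Y)`. Moreover `[X̂, v] = 0`, because
horizontal lifts are invariant under the circle. The Koszul formula then gives the whole connection:
`D_X̂ Ŷ` is the lift of `∇_X Y` plus `g(φX, Y) v`, both `D_X̂ v` and `D_v X̂` are the lift of `φX`,
and `D_v v = 0`.

On a Sasakian manifold `∇_X ξ = -φX`, so the two contributions to `D(ξ̂ + v)` cancel and `r` is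
parallel. Hence `R(·,·) r = 0`, and the symmetries of the curvature tensor give `R(r, ·) = 0`.

For `Z` in `𝒟`, replacing `v` by `r - ξ̂` turns the formula for `D_X̂ Ẑ` into the lift of `∇^𝒟_X Z`,
plus `g(φX, Z) r`, minus `η(X)` times the lift of `φZ`. For `X`, `Y` in `𝒟` the last term enters
only through `[X, Y]`, where the vertical part of `[X̂, Ŷ]` cancels it. The coefficients of `r`
cancel by the formula for `∇φ`, which leaves the lift of `R^𝒟`. The remaining identities follow from
the same table of derivatives, `φ² = -1` on `𝒟`, and `r̃ = r - 2v`.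

The supporting results are the commutator formula for brackets (`mvfderiv_bracket`),
`bracket_lift_vert`, `im_bracket_lift_addPullback`, `covDeriv_lift_lift` and
`covDeriv_reeb_add_vert`. -/

namespace KaluzaKlein

/-! ### Smooth vector fields: brackets as commutators, and related fields. -/

section VectorFields

variable {m : ℕ} {M : Type*} [TopologicalSpace M] [ChartedSpace (EuclideanSpace ℝ (Fin m)) M]
  [IsManifold (𝓡 m) ∞ M]

theorem IsSmoothField.mdifferentiableAt {X : VField m M} (hX : IsSmoothField X) (x : M) :
    MDifferentiableAt (𝓡 m) (𝓡 m).tangent (fun y : M => (⟨y, X y⟩ : TangentBundle (𝓡 m) M)) x :=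
  ContMDiff.mdifferentiable hX (by simp) x

theorem IsSmoothField.add {X Y : VField m M} (hX : IsSmoothField X) (hY : IsSmoothField Y) :
    IsSmoothField (X + Y) := ContMDiff.add_section hX hY

theorem IsSmoothField.sub {X Y : VField m M} (hX : IsSmoothField X) (hY : IsSmoothField Y) :
    IsSmoothField (X - Y) := ContMDiff.sub_section hX hY

theorem IsSmoothField.neg {X : VField m M} (hX : IsSmoothField X) :
    IsSmoothField (-X) := ContMDiff.neg_section hX

theorem IsSmoothField.smul {X : VField m M} {f : M → ℝ} (hf : ContMDiff (𝓡 m) 𝓘(ℝ, ℝ) ∞ f)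
    (hX : IsSmoothField X) : IsSmoothField (f • X) := ContMDiff.smul_section hf hX

theorem IsSmoothField.const_smul {X : VField m M} (c : ℝ)
    (hX : IsSmoothField X) : IsSmoothField (c • X) := ContMDiff.const_smul_section hX

theorem IsSmoothField.zero : IsSmoothField (0 : VField m M) :=
  Bundle.contMDiff_zeroSection ℝ (TangentSpace (𝓡 m) : M → Type _)

theorem IsSmoothField.bracket {X Y : VField m M} (hX : IsSmoothField X) (hY : IsSmoothField Y) :
    IsSmoothField (bracket X Y) := fun x => by
  have : IsManifold (𝓡 m) (minSmoothness ℝ 2) M :=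
    IsManifold.of_le (n := ∞) (by simpa using! (WithTop.coe_le_coe.2 le_top : ((2 : ℕ∞) : WithTop ℕ∞) ≤ ∞))
  have : IsManifold (𝓡 m) (((⊤ : ℕ∞) : WithTop ℕ∞) + 1) M := by simpa
  exact ContMDiffAt.mlieBracket_vectorField (n := ⊤) (m := ⊤) (hX x) (hY x) (by simp)

theorem IsSmoothField.covDeriv {D : TangentConnection m M}
    (hD : CovariantDerivative.ContMDiffCovariantDerivative D ∞)
    {X Y : VField m M} (hX : IsSmoothField X) (hY : IsSmoothField Y) :
    IsSmoothField (covDeriv D X Y) := by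
  have h := hD.contMDiff.contMDiff (σ := Y) (ContMDiff.contMDiffOn hY)
  rw [contMDiffOn_univ] at h
  exact ContMDiff.clm_bundle_apply h hX

/-- Every tangent vector is the value of a smooth vector field. -/
theorem exists_isSmoothField_eq [T2Space M] (x : M) (w : TangentSpace (𝓡 m) x) :
    ∃ X : VField m M, IsSmoothField X ∧ X x = w := by
  -- A local extension of `w`, smooth near `x`, is cut off by a bump function equal to 1 at `x`.
  obtain ⟨s, hs, hsm⟩ := FiberBundle.exists_contMDiffOn_extend (𝓡 m) (k := ∞)
    (EuclideanSpace ℝ (Fin m)) (V := (TangentSpace (𝓡 m) : M → Type _)) w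
  obtain ⟨u, hus, huo, hxu⟩ := mem_nhds_iff.1 hs
  obtain ⟨f, -, hf⟩ := (SmoothBumpFunction.nhds_basis_tsupport (I := 𝓡 m) x).mem_iff.1
    (huo.mem_nhds hxu)
  refine ⟨(f : M → ℝ) • FiberBundle.extend (EuclideanSpace ℝ (Fin m)) w,
    ContMDiffOn.smul_section_of_tsupport f.contMDiff.contMDiffOn huo hf (hsm.mono hus), ?_⟩
  simp

omit [IsManifold (𝓡 m) ∞ M] in
theorem mvfderiv_congr {F : Type*} [NormedAddCommGroup F] [NormedSpace ℝ F] {f g : M → F} {x : M}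
    (h : f =ᶠ[nhds x] g) (w : TangentSpace (𝓡 m) x) :
    mvfderiv (𝓡 m) f x w = mvfderiv (𝓡 m) g x w :=
  congrArg (fun L : EuclideanSpace ℝ (Fin m) →L[ℝ] F => L w) h.mfderiv_eq

theorem contMDiffOn_mvfderiv_apply {F : Type*} [NormedAddCommGroup F] [NormedSpace ℝ F]
    {f : M → F} {U : Set M} (hU : IsOpen U) (hf : ContMDiffOn (𝓡 m) 𝓘(ℝ, F) ∞ f U)
    {X : VField m M} (hX : IsSmoothField X) :
    ContMDiffOn (𝓡 m) 𝓘(ℝ, F) ∞ (fun x => mvfderiv (𝓡 m) f x (X x)) U := by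
  have h1 := hf.contMDiffOn_tangentMapWithin (m := ∞) (by simp) hU.uniqueMDiffOn
  have h2 := h1.comp (ContMDiff.contMDiffOn (s := U) hX) (fun x hx => hx)
  have h3 := (contMDiff_snd_tangentBundle_modelSpace (n := ∞) F 𝓘(ℝ, F)).comp_contMDiffOn h2
  refine h3.congr fun x hx => ?_
  simp only [Function.comp, tangentMapWithin]
  rw [mfderivWithin_of_isOpen hU hx]
  rfl

theorem bracket_smul_right {V W : VField m M} {f : M → ℝ} {x : M}
    (hf : MDifferentiableAt (𝓡 m) 𝓘(ℝ, ℝ) f x)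
    (hW : MDifferentiableAt (𝓡 m) (𝓡 m).tangent
      (fun y : M => (⟨y, W y⟩ : TangentBundle (𝓡 m) M)) x) :
    bracket V (f • W) x = mvfderiv (𝓡 m) f x (V x) • W x + f x • bracket V W x :=
  VectorField.mlieBracket_smul_right hf hW

/-- This comes from the Jacobi identity, with no computation in charts. Expanding it for `X`, `Y`,
`f Z` by the Leibniz rule and removing `f` times the identity for `X`, `Y`, `Z` leaves the claimed
difference as a multiple of `Z`; it remains to choose `Z` nonzero at `x`. -/
theorem mvfderiv_bracket_real [T2Space M] {f : M → ℝ} {U : Set M} (hU : IsOpen U)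
    (hf : ContMDiffOn (𝓡 m) 𝓘(ℝ, ℝ) ∞ f U) {X Y : VField m M} (hX : IsSmoothField X)
    (hY : IsSmoothField Y) {x : M} (hx : x ∈ U) :
    mvfderiv (𝓡 m) f x (bracket X Y x) =
      mvfderiv (𝓡 m) (fun y => mvfderiv (𝓡 m) f y (Y y)) x (X x) -
        mvfderiv (𝓡 m) (fun y => mvfderiv (𝓡 m) f y (X y)) x (Y x) := by
  -- In dimension zero no such `Z` exists, but then every derivative vanishes.
  by_cases hz : ∀ w : TangentSpace (𝓡 m) x, w = 0
  · rw [hz (bracket X Y x), hz (X x), hz (Y x)]; simp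
  push Not at hz
  obtain ⟨w, hw⟩ := hz
  obtain ⟨Z, hZ, rfl⟩ := exists_isSmoothField_eq x w
  have hat : ∀ {g : M → ℝ}, ContMDiffOn (𝓡 m) 𝓘(ℝ, ℝ) ∞ g U → ∀ y ∈ U,
      MDifferentiableAt (𝓡 m) 𝓘(ℝ, ℝ) g y := fun hg y hy =>
    (hg.contMDiffAt (hU.mem_nhds hy)).mdifferentiableAt (by simp)
  have hfZ : ContMDiffAt (𝓡 m) (𝓡 m).tangent ∞
      (fun y : M => (⟨y, (f • Z) y⟩ : TangentBundle (𝓡 m) M)) x :=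
    ContMDiffAt.smul_section (hf.contMDiffAt (hU.mem_nhds hx)) (hZ x)
  have key : ∀ {V W : VField m M}, IsSmoothField V → IsSmoothField W →
      bracket V (bracket W (f • Z)) x =
        mvfderiv (𝓡 m) (fun y => mvfderiv (𝓡 m) f y (W y)) x (V x) • Z x
          + mvfderiv (𝓡 m) f x (W x) • bracket V Z x
          + (mvfderiv (𝓡 m) f x (V x) • bracket W Z x
          + f x • bracket V (bracket W Z) x) := by
    intro V W hV hW
    have h1 : bracket W (f • Z) =ᶠ[nhds x]
        (fun y => mvfderiv (𝓡 m) f y (W y)) • Z + f • bracket W Z := by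
      filter_upwards [hU.mem_nhds hx] with y hy
      exact bracket_smul_right (hat hf y hy) (hZ.mdifferentiableAt y)
    have hg := contMDiffOn_mvfderiv_apply hU hf hW
    have h2 := hg.contMDiffAt (hU.mem_nhds hx)
    have h3 := hf.contMDiffAt (hU.mem_nhds hx)
    have s1 := ContMDiffAt.smul_section h2 (hZ x)
    have s2 := ContMDiffAt.smul_section h3 (hW.bracket hZ x)
    have h4 : bracket V (bracket W (f • Z)) x =
        bracket V ((fun y => mvfderiv (𝓡 m) f y (W y)) • Z + f • bracket W Z) x :=
      (Filter.EventuallyEq.refl _ V).mlieBracket_vectorField_eq h1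
    rw [h4]
    refine (VectorField.mlieBracket_add_right (s1.mdifferentiableAt (by simp))
      (s2.mdifferentiableAt (by simp))).trans ?_
    rw [← bracket_smul_right (hat hg x hx) (hZ.mdifferentiableAt x),
      ← bracket_smul_right (hat hf x hx) ((hW.bracket hZ).mdifferentiableAt x)]
  have hmin : minSmoothness ℝ 2 ≤ (∞ : WithTop ℕ∞) := by
    simpa using! (WithTop.coe_le_coe.2 le_top : ((2 : ℕ∞) : WithTop ℕ∞) ≤ ∞)
  have : IsManifold (𝓡 m) (minSmoothness ℝ 3) M := IsManifold.of_le (n := ∞)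
    (by simpa using! (WithTop.coe_le_coe.2 le_top : ((3 : ℕ∞) : WithTop ℕ∞) ≤ ∞))
  have hJ := VectorField.leibniz_identity_mlieBracket_apply ((hX x).of_le hmin)
    ((hY x).of_le hmin) (hfZ.of_le hmin)
  have hJ' := VectorField.leibniz_identity_mlieBracket_apply ((hX x).of_le hmin)
    ((hY x).of_le hmin) ((hZ x).of_le hmin)
  have k1 := key hX hY
  have k2 := key hY hX
  have k3 := bracket_smul_right (V := bracket X Y) (hat hf x hx) (hZ.mdifferentiableAt x)
  simp only [bracket] at k1 k2 k3
  rw [k1, k2, k3, hJ'] at hJ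
  have h5 : (mvfderiv (𝓡 m) f x (bracket X Y x) -
      (mvfderiv (𝓡 m) (fun y => mvfderiv (𝓡 m) f y (Y y)) x (X x) -
        mvfderiv (𝓡 m) (fun y => mvfderiv (𝓡 m) f y (X y)) x (Y x))) • Z x = 0 := by
    -- The mixed terms, a derivative of `f` times `[X, Z]` or `[Y, Z]`, occur on both sides and
    -- cancel.
    linear_combination (norm := module) -hJ
  exact sub_eq_zero.1 ((smul_eq_zero.1 h5).resolve_right hw)

omit [IsManifold (𝓡 m) ∞ M] in
theorem mvfderiv_clm_comp {F : Type*} [NormedAddCommGroup F] [NormedSpace ℝ F] (L : F →L[ℝ] ℝ)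
    {f : M → F} {x : M} (hf : MDifferentiableAt (𝓡 m) 𝓘(ℝ, F) f x) (w : TangentSpace (𝓡 m) x) :
    mvfderiv (𝓡 m) (fun y => L (f y)) x w = L (mvfderiv (𝓡 m) f x w) := by
  have h := mfderiv_comp_apply x (L.differentiableAt.mdifferentiableAt (x := f x)) hf w
  rw [mfderiv_eq_fderiv, L.fderiv] at h
  exact h

/-- A Lie bracket acts on functions as a commutator. -/
theorem mvfderiv_bracket [T2Space M] {F : Type*} [NormedAddCommGroup F] [NormedSpace ℝ F]
    {f : M → F} {U : Set M} (hU : IsOpen U)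
    (hf : ContMDiffOn (𝓡 m) 𝓘(ℝ, F) ∞ f U) {X Y : VField m M} (hX : IsSmoothField X)
    (hY : IsSmoothField Y) {x : M} (hx : x ∈ U) :
    mvfderiv (𝓡 m) f x (bracket X Y x) =
      mvfderiv (𝓡 m) (fun y => mvfderiv (𝓡 m) f y (Y y)) x (X x) -
        mvfderiv (𝓡 m) (fun y => mvfderiv (𝓡 m) f y (X y)) x (Y x) := by
  -- Continuous linear functionals separate points of `F`, which reduces to the real-valued case.
  refine (SeparatingDual.eq_iff_forall_dual_eq (R := ℝ)).2 fun L => ?_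
  have hat : ∀ {g : M → F}, ContMDiffOn (𝓡 m) 𝓘(ℝ, F) ∞ g U → ∀ y ∈ U,
      MDifferentiableAt (𝓡 m) 𝓘(ℝ, F) g y := fun hg y hy =>
    (hg.contMDiffAt (hU.mem_nhds hy)).mdifferentiableAt (by simp)
  have key : ∀ {V W : VField m M}, IsSmoothField W →
      L (mvfderiv (𝓡 m) (fun y => mvfderiv (𝓡 m) f y (W y)) x (V x)) =
        mvfderiv (𝓡 m) (fun y => mvfderiv (𝓡 m) (fun y => L (f y)) y (W y)) x (V x) := by
    intro V W hW
    rw [← mvfderiv_clm_comp L (hat (contMDiffOn_mvfderiv_apply hU hf hW) x hx)]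
    have : (fun y => L (mvfderiv (𝓡 m) f y (W y))) =ᶠ[nhds x]
        (fun y => mvfderiv (𝓡 m) (fun y => L (f y)) y (W y)) := by
      filter_upwards [hU.mem_nhds hx] with y hy
      rw [mvfderiv_clm_comp L (hat hf y hy)]
    exact mvfderiv_congr this _
  rw [map_sub, key hY, key hX, ← mvfderiv_clm_comp L (hat hf x hx)]
  exact mvfderiv_bracket_real hU (L.contMDiff.comp_contMDiffOn hf) hX hY hx

/-- Lie brackets of related vector fields are related. -/
theorem mfderiv_bracket_of_related [T2Space M] {k : ℕ} {N : Type*} [TopologicalSpace N] [T2Space N]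
    [ChartedSpace (EuclideanSpace ℝ (Fin k)) N] [IsManifold (𝓡 k) ∞ N]
    {F : M → N} (hF : ContMDiff (𝓡 m) (𝓡 k) ∞ F) {U V : VField m M} {X Y : VField k N}
    (hU : IsSmoothField U) (hV : IsSmoothField V) (hX : IsSmoothField X) (hY : IsSmoothField Y)
    (hUX : ∀ p, mfderiv (𝓡 m) (𝓡 k) F p (U p) = X (F p))
    (hVY : ∀ p, mfderiv (𝓡 m) (𝓡 k) F p (V p) = Y (F p)) (p : M) :
    mfderiv (𝓡 m) (𝓡 k) F p (bracket U V p) = bracket X Y (F p) := by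
  -- A chart of `N` serves as a vector-valued test function: its differential is injective, so a
  -- tangent vector at `F p` is determined by its action on `f`.
  set f := extChartAt (𝓡 k) (F p) with hf
  set W := (chartAt (EuclideanSpace ℝ (Fin k)) (F p)).source with hW
  have hWo : IsOpen W := (chartAt _ (F p)).open_source
  have hfs : ContMDiffOn (𝓡 k) 𝓘(ℝ, EuclideanSpace ℝ (Fin k)) ∞ f W := contMDiffOn_extChartAt
  have hpW : F p ∈ W := mem_chart_source _ _
  have hFo : IsOpen (F ⁻¹' W) := hWo.preimage hF.continuous
  have hcomp : ∀ {g : N → EuclideanSpace ℝ (Fin k)},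
      ContMDiffOn (𝓡 k) 𝓘(ℝ, EuclideanSpace ℝ (Fin k)) ∞ g W → ∀ q ∈ F ⁻¹' W,
      ∀ w : TangentSpace (𝓡 m) q,
      mvfderiv (𝓡 m) (g ∘ F) q w = mvfderiv (𝓡 k) g (F q) (mfderiv (𝓡 m) (𝓡 k) F q w) :=
    fun hg q hq w => mfderiv_comp_apply q
      ((hg.contMDiffAt (hWo.mem_nhds hq)).mdifferentiableAt (by simp))
      (hF.mdifferentiable (by simp) q) w
  have hfF : ContMDiffOn (𝓡 m) 𝓘(ℝ, EuclideanSpace ℝ (Fin k)) ∞ (f ∘ F) (F ⁻¹' W) :=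
    hfs.comp hF.contMDiffOn (fun q hq => hq)
  have key : ∀ {V₁ V₂ : VField m M} {Y₁ Y₂ : VField k N}, IsSmoothField Y₂ →
      (∀ p, mfderiv (𝓡 m) (𝓡 k) F p (V₁ p) = Y₁ (F p)) →
      (∀ p, mfderiv (𝓡 m) (𝓡 k) F p (V₂ p) = Y₂ (F p)) →
      mvfderiv (𝓡 m) (fun q => mvfderiv (𝓡 m) (f ∘ F) q (V₂ q)) p (V₁ p) =
        mvfderiv (𝓡 k) (fun y => mvfderiv (𝓡 k) f y (Y₂ y)) (F p) (Y₁ (F p)) := by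
    intro V₁ V₂ Y₁ Y₂ hY₂ h1 h2
    rw [← h1, ← hcomp (contMDiffOn_mvfderiv_apply hWo hfs hY₂) p hpW]
    have : (fun q => mvfderiv (𝓡 m) (f ∘ F) q (V₂ q)) =ᶠ[nhds p]
        ((fun y => mvfderiv (𝓡 k) f y (Y₂ y)) ∘ F) := by
      filter_upwards [hFo.mem_nhds hpW] with q hq
      rw [hcomp hfs q hq, h2]; rfl
    exact mvfderiv_congr this _
  have h := mvfderiv_bracket hFo hfF hU hV hpW
  rw [hcomp hfs p hpW, key hY hUX hVY, key hX hVY hUX, ← mvfderiv_bracket hWo hfs hX hY hpW] at h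
  have hinj := (isInvertible_mfderiv_extChartAt (I := 𝓡 k)
    (mem_extChartAt_source (I := 𝓡 k) (F p))).injective
  exact hinj h

end VectorFields

end KaluzaKlein

/-! ### Levi-Civita connections: Koszul formula, curvature symmetries, parallel fields. -/

namespace KaluzaKlein

section LeviCivita

variable {m : ℕ} {M : Type*} [TopologicalSpace M] [ChartedSpace (EuclideanSpace ℝ (Fin m)) M]
  [IsManifold (𝓡 m) ∞ M]

/-- A field of symmetric bilinear forms. -/
structure IsSymmBilin (h : Π x : M, TangentSpace (𝓡 m) x → TangentSpace (𝓡 m) x → ℝ) : Prop where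
  symm : ∀ x u w, h x u w = h x w u
  add_left : ∀ x u u' w, h x (u + u') w = h x u w + h x u' w
  smul_left : ∀ x (c : ℝ) u w, h x (c • u) w = c * h x u w

namespace IsSymmBilin

variable {h : Π x : M, TangentSpace (𝓡 m) x → TangentSpace (𝓡 m) x → ℝ} (H : IsSymmBilin h)
include H

omit [IsManifold (𝓡 m) ∞ M] in
theorem neg_left (x : M) (u w : TangentSpace (𝓡 m) x) : h x (-u) w = -h x u w := by
  rw [← neg_one_smul ℝ u, H.smul_left]; ring

omit [IsManifold (𝓡 m) ∞ M] in
theorem sub_left (x : M) (u u' w : TangentSpace (𝓡 m) x) :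
    h x (u - u') w = h x u w - h x u' w := by
  rw [sub_eq_add_neg, H.add_left, H.neg_left]; ring

omit [IsManifold (𝓡 m) ∞ M] in
theorem zero_left (x : M) (w : TangentSpace (𝓡 m) x) : h x 0 w = 0 := by
  rw [← zero_smul ℝ (0 : TangentSpace (𝓡 m) x), H.smul_left]; ring

omit [IsManifold (𝓡 m) ∞ M] in
theorem smul_right (x : M) (c : ℝ) (u w : TangentSpace (𝓡 m) x) :
    h x u (c • w) = c * h x u w := by
  rw [H.symm, H.smul_left, H.symm]

omit [IsManifold (𝓡 m) ∞ M] in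
theorem neg_right (x : M) (u w : TangentSpace (𝓡 m) x) : h x u (-w) = -h x u w := by
  rw [H.symm, H.neg_left, H.symm]

omit [IsManifold (𝓡 m) ∞ M] in
theorem sub_right (x : M) (u w w' : TangentSpace (𝓡 m) x) :
    h x u (w - w') = h x u w - h x u w' := by
  rw [H.symm, H.sub_left, H.symm, H.symm x w']

omit [IsManifold (𝓡 m) ∞ M] in
theorem zero_right (x : M) (u : TangentSpace (𝓡 m) x) : h x u 0 = 0 := by
  rw [H.symm, H.zero_left]

end IsSymmBilin

variable {D : TangentConnection m M}

theorem covDeriv_add (X : VField m M) {Y Z : VField m M} (hY : IsSmoothField Y)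
    (hZ : IsSmoothField Z) : covDeriv D X (Y + Z) = covDeriv D X Y + covDeriv D X Z := by
  funext x
  exact congrArg (fun L : TangentSpace (𝓡 m) x →L[ℝ] TangentSpace (𝓡 m) x => L (X x))
    (D.isCovariantDerivativeOnUniv.add (hY.mdifferentiableAt x) (hZ.mdifferentiableAt x))

theorem covDeriv_smul (X : VField m M) {Y : VField m M} {f : M → ℝ}
    (hf : ContMDiff (𝓡 m) 𝓘(ℝ, ℝ) ∞ f) (hY : IsSmoothField Y) :
    covDeriv D X (f • Y) = f • covDeriv D X Y + (fun x => mvfderiv (𝓡 m) f x (X x)) • Y := by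
  funext x
  exact congrArg (fun L : TangentSpace (𝓡 m) x →L[ℝ] TangentSpace (𝓡 m) x => L (X x))
    (D.isCovariantDerivativeOnUniv.leibniz (hY.mdifferentiableAt x)
      (hf.mdifferentiable (by simp) x))

theorem covDeriv_const_smul (X : VField m M) {Y : VField m M} (c : ℝ) (hY : IsSmoothField Y) :
    covDeriv D X (c • Y) = c • covDeriv D X Y := by
  have h := covDeriv_smul (D := D) X (f := fun _ => c) contMDiff_const hY
  simp only [mvfderiv_const] at h
  refine h.trans ?_
  funext x
  exact (congrArg (c • covDeriv D X Y x + ·) (zero_smul ℝ (Y x))).trans (add_zero _)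

theorem covDeriv_neg (X : VField m M) {Y : VField m M} (hY : IsSmoothField Y) :
    covDeriv D X (-Y) = -covDeriv D X Y := by
  have h := covDeriv_const_smul (D := D) X (-1) hY
  rwa [neg_one_smul, neg_one_smul] at h

theorem covDeriv_sub (X : VField m M) {Y Z : VField m M} (hY : IsSmoothField Y)
    (hZ : IsSmoothField Z) : covDeriv D X (Y - Z) = covDeriv D X Y - covDeriv D X Z := by
  rw [sub_eq_add_neg, covDeriv_add X hY hZ.neg, covDeriv_neg X hZ, sub_eq_add_neg]

theorem covDeriv_zero (X : VField m M) : covDeriv D X 0 = 0 := by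
  funext x; simp [covDeriv]

theorem covDeriv_add_left (X X' Y : VField m M) :
    covDeriv D (X + X') Y = covDeriv D X Y + covDeriv D X' Y := by
  funext x; simp [covDeriv]

theorem covDeriv_sub_left (X X' Y : VField m M) :
    covDeriv D (X - X') Y = covDeriv D X Y - covDeriv D X' Y := by
  funext x; simp [covDeriv]

theorem covDeriv_smul_left (f : M → ℝ) (X Y : VField m M) :
    covDeriv D (f • X) Y = f • covDeriv D X Y := by
  funext x; simp [covDeriv]

namespace IsLeviCivita

variable {h : Π x : M, TangentSpace (𝓡 m) x → TangentSpace (𝓡 m) x → ℝ}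

theorem covDeriv_sub_covDeriv (hD : IsLeviCivita h D) {X Y : VField m M} (hX : IsSmoothField X)
    (hY : IsSmoothField Y) : covDeriv D X Y - covDeriv D Y X = bracket X Y := by
  have : IsManifold (𝓡 m) 2 M :=
    IsManifold.of_le (n := ∞) (WithTop.coe_le_coe.2 le_top : ((2 : ℕ∞) : WithTop ℕ∞) ≤ ∞)
  funext x
  exact D.torsion_eq_zero_iff.1 hD.torsion_free (hX.mdifferentiableAt x) (hY.mdifferentiableAt x)

theorem mvfderiv_metric (hD : IsLeviCivita h D) {Y Z : VField m M} (hY : IsSmoothField Y)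
    (hZ : IsSmoothField Z) (X : VField m M) (x : M) :
    mvfderiv (𝓡 m) (fun y => h y (Y y) (Z y)) x (X x) =
      h x (covDeriv D X Y x) (Z x) + h x (Y x) (covDeriv D X Z x) :=
  hD.metric x (X x) Y Z (hY.mdifferentiableAt x) (hZ.mdifferentiableAt x)

theorem koszul (hD : IsLeviCivita h D) (H : IsSymmBilin h) {X Y Z : VField m M}
    (hX : IsSmoothField X) (hY : IsSmoothField Y) (hZ : IsSmoothField Z) (x : M) :
    2 * h x (covDeriv D X Y x) (Z x) =
      mvfderiv (𝓡 m) (fun y => h y (Y y) (Z y)) x (X x)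
        + mvfderiv (𝓡 m) (fun y => h y (X y) (Z y)) x (Y x)
        - mvfderiv (𝓡 m) (fun y => h y (X y) (Y y)) x (Z x)
        + h x (bracket X Y x) (Z x) - h x (bracket X Z x) (Y x) - h x (bracket Y Z x) (X x) := by
  rw [hD.mvfderiv_metric hY hZ, hD.mvfderiv_metric hX hZ, hD.mvfderiv_metric hX hY,
    ← hD.covDeriv_sub_covDeriv hX hY, ← hD.covDeriv_sub_covDeriv hX hZ,
    ← hD.covDeriv_sub_covDeriv hY hZ]
  simp only [Pi.sub_apply, H.sub_left]
  rw [H.symm x (Y x), H.symm x (X x), H.symm x (X x)]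
  ring

/-- The first Bianchi identity. -/
theorem bianchi (hD : IsLeviCivita h D) {X Y Z : VField m M}
    (hX : IsSmoothField X) (hY : IsSmoothField Y) (hZ : IsSmoothField Z) :
    curvature D X Y Z + curvature D Y Z X + curvature D Z X Y = 0 := by
  have hsm : ∀ {U V : VField m M}, IsSmoothField U → IsSmoothField V →
      IsSmoothField (covDeriv D U V) := fun hU hV => hU.covDeriv hD.smooth hV
  -- Torsion-freeness, used twice, gathers the six second derivatives in pairs into double brackets,
  -- so the cyclic sum becomes the Jacobi identity.
  have key : ∀ {U V W : VField m M}, IsSmoothField U → IsSmoothField V → IsSmoothField W →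
      covDeriv D U (covDeriv D V W) - covDeriv D U (covDeriv D W V) - covDeriv D (bracket V W) U =
        bracket U (bracket V W) := by
    intro U V W hU hV hW
    rw [← covDeriv_sub U (hsm hV hW) (hsm hW hV), hD.covDeriv_sub_covDeriv hV hW,
      hD.covDeriv_sub_covDeriv hU (hV.bracket hW)]
  have hmin : minSmoothness ℝ 2 ≤ (∞ : WithTop ℕ∞) := by
    simpa using! (WithTop.coe_le_coe.2 le_top : ((2 : ℕ∞) : WithTop ℕ∞) ≤ ∞)
  have : IsManifold (𝓡 m) (minSmoothness ℝ 3) M := IsManifold.of_le (n := ∞)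
    (by simpa using! (WithTop.coe_le_coe.2 le_top : ((3 : ℕ∞) : WithTop ℕ∞) ≤ ∞))
  have hJ : bracket X (bracket Y Z) = bracket (bracket X Y) Z + bracket Y (bracket X Z) :=
    VectorField.leibniz_identity_mlieBracket (ContMDiff.of_le hX hmin) (ContMDiff.of_le hY hmin)
      (ContMDiff.of_le hZ hmin)
  have h1 : bracket (bracket X Y) Z = -bracket Z (bracket X Y) := VectorField.mlieBracket_swap
  have h2 : bracket Z X = -bracket X Z := VectorField.mlieBracket_swap
  have h3 : bracket Y (bracket X Z) = -bracket Y (bracket Z X) := by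
    rw [h2, ← neg_one_smul ℝ (bracket X Z)]
    have : bracket Y ((-1 : ℝ) • bracket X Z) = (-1 : ℝ) • bracket Y (bracket X Z) := by
      funext x
      exact VectorField.mlieBracket_const_smul_right ((hX.bracket hZ).mdifferentiableAt x)
    rw [this, neg_one_smul, neg_neg]
  rw [h1, h3, ← key hX hY hZ, ← key hZ hX hY, ← key hY hZ hX] at hJ
  simp only [curvature]
  rw [← sub_eq_zero] at hJ
  rw [← hJ]
  abel

/-- The function `h(Z, W)` is differentiated twice by metricity. Antisymmetrizing in `X` and `Y`
removes the products of first derivatives, and the commutator formula accounts for the bracket term.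
-/
theorem curvature_skew [T2Space M] (hD : IsLeviCivita h D) (H : IsSymmBilin h)
    (hh : ∀ Y Z : VField m M, IsSmoothField Y → IsSmoothField Z →
      ContMDiff (𝓡 m) 𝓘(ℝ, ℝ) ∞ (fun x => h x (Y x) (Z x)))
    {X Y Z W : VField m M} (hX : IsSmoothField X) (hY : IsSmoothField Y) (hZ : IsSmoothField Z)
    (hW : IsSmoothField W) (x : M) :
    h x (curvature D X Y Z x) (W x) + h x (Z x) (curvature D X Y W x) = 0 := by
  have hsm : ∀ {U V : VField m M}, IsSmoothField U → IsSmoothField V →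
      IsSmoothField (covDeriv D U V) := fun hU hV => hU.covDeriv hD.smooth hV
  have key : ∀ {U V : VField m M}, IsSmoothField U → IsSmoothField V →
      mvfderiv (𝓡 m) (fun y => mvfderiv (𝓡 m) (fun y => h y (Z y) (W y)) y (V y)) x (U x) =
      (h x (covDeriv D U (covDeriv D V Z) x) (W x) + h x (covDeriv D V Z x) (covDeriv D U W x)) +
      (h x (covDeriv D U Z x) (covDeriv D V W x) + h x (Z x) (covDeriv D U (covDeriv D V W) x)) := by
    intro U V hU hV
    rw [← hD.mvfderiv_metric (hsm hV hZ) hW, ← hD.mvfderiv_metric hZ (hsm hV hW)]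
    have h1 : (fun y => mvfderiv (𝓡 m) (fun y => h y (Z y) (W y)) y (V y)) =
        (fun y => h y (covDeriv D V Z y) (W y)) + fun y => h y (Z y) (covDeriv D V W y) := by
      funext y; exact hD.mvfderiv_metric hZ hW V y
    rw [h1, mvfderiv_add ((hh _ _ (hsm hV hZ) hW).mdifferentiable (by simp) x)
      ((hh _ _ hZ (hsm hV hW)).mdifferentiable (by simp) x)]
    rfl
  have h1 := mvfderiv_bracket isOpen_univ (hh Z W hZ hW).contMDiffOn hX hY (Set.mem_univ x)
  rw [key hX hY, key hY hX, hD.mvfderiv_metric hZ hW] at h1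
  simp only [curvature, Pi.sub_apply, H.sub_left, H.sub_right]
  linarith

theorem curvature_parallel {r : VField m M} (hr : ∀ X : VField m M, covDeriv D X r = 0)
    (U V : VField m M) : curvature D U V r = 0 := by
  simp [curvature, hr, covDeriv_zero]

theorem curvature_swap (D : TangentConnection m M) (X Y Z : VField m M) :
    curvature D X Y Z = -curvature D Y X Z := by
  have h1 : bracket Y X = (-1 : M → ℝ) • bracket X Y := by
    rw [show bracket Y X = -bracket X Y from VectorField.mlieBracket_swap]
    funext x; simp
  rw [curvature, curvature, h1, covDeriv_smul_left]
  funext x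
  simp
  abel

/-- For the Levi-Civita connection of a nondegenerate form, contracting the curvature with a
parallel field gives zero. -/
theorem curvature_parallel_left [T2Space M] (hD : IsLeviCivita h D) (H : IsSymmBilin h)
    (hh : ∀ Y Z : VField m M, IsSmoothField Y → IsSmoothField Z →
      ContMDiff (𝓡 m) 𝓘(ℝ, ℝ) ∞ (fun x => h x (Y x) (Z x)))
    (hnd : ∀ x u, (∀ w, h x u w = 0) → u = 0)
    {r : VField m M} (hrs : IsSmoothField r) (hr : ∀ X : VField m M, covDeriv D X r = 0)
    {U W : VField m M} (hU : IsSmoothField U) (hW : IsSmoothField W) : curvature D r U W = 0 := by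
  -- In the Bianchi identity for `r`, `U`, `W`, the term `R(U, W) r` vanishes because `r` is
  -- parallel.
  have hsymm : ∀ {U W : VField m M}, IsSmoothField U → IsSmoothField W →
      curvature D r U W = curvature D r W U := by
    intro U W hU hW
    have h1 := hD.bianchi hrs hU hW
    rw [curvature_parallel hr, curvature_swap D W r U, add_zero, ← sub_eq_add_neg] at h1
    exact sub_eq_zero.1 h1
  funext x
  refine hnd x _ fun w => ?_
  obtain ⟨Z, hZ, rfl⟩ := exists_isSmoothField_eq x w
  have hskew : ∀ {A B C : VField m M}, IsSmoothField A → IsSmoothField B → IsSmoothField C →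
      h x (curvature D r A B x) (C x) = -h x (curvature D r A C x) (B x) := by
    intro A B C hA hB hC
    have := hD.curvature_skew H hh hrs hA hB hC x
    rw [H.symm x (B x)] at this
    linarith
  -- The trilinear form `h(R(r, A) B, C)` is symmetric in `A`, `B` and skew in `B`, `C`. Alternating
  -- the two symmetries three times returns the form with the opposite sign, so it is zero.
  have e1 := hskew hU hW hZ
  have e2 := hskew hZ hU hW
  have e3 := hskew hW hZ hU
  rw [hsymm hU hZ] at e1
  rw [hsymm hZ hW] at e2
  rw [hsymm hW hU] at e3
  linarith

end IsLeviCivita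

end LeviCivita

end KaluzaKlein

/-! ### Circle bundles: the vertical field, horizontal lifts and their brackets. -/

namespace KaluzaKlein

section Bundles

variable {m : ℕ} {B P : Type*}
  [TopologicalSpace B] [ChartedSpace (EuclideanSpace ℝ (Fin m)) B] [IsManifold (𝓡 m) ∞ B]
  [TopologicalSpace P] [ChartedSpace (EuclideanSpace ℝ (Fin (m + 1))) P]
  [IsManifold (𝓡 (m + 1)) ∞ P] [MulAction Circle P]

namespace PrincipalCircleBundle

section Vertical

variable (π : PrincipalCircleBundle m B P)

theorem mvfderiv_comp_proj {F : Type*} [NormedAddCommGroup F] [NormedSpace ℝ F] {f : B → F}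
    (p : P) (hf : MDifferentiableAt (𝓡 m) 𝓘(ℝ, F) f (π.proj p)) (u : TangentSpace (𝓡 (m + 1)) p) :
    mvfderiv (𝓡 (m + 1)) (fun q => f (π.proj q)) p u =
      mvfderiv (𝓡 m) f (π.proj p) (π.dproj p u) :=
  mfderiv_comp_apply p hf (π.proj_smooth.mdifferentiable (by simp) p) u

include π in
theorem contMDiff_expAct :
    ContMDiff (𝓘(ℝ, ℝ).prod (𝓡 (m + 1))) (𝓡 (m + 1)) ∞
      (fun q : ℝ × P => Circle.exp q.1 • q.2) :=
  π.smul_smooth.comp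
    ((contMDiff_circleExp.comp contMDiff_fst).prodMk contMDiff_snd)

include π in
theorem contMDiff_smul (z : Circle) :
    ContMDiff (𝓡 (m + 1)) (𝓡 (m + 1)) ∞ (fun q : P => z • q) :=
  π.smul_smooth.comp (contMDiff_const.prodMk contMDiff_id)

include π in
theorem contMDiff_orbit (p : P) :
    ContMDiff 𝓘(ℝ, ℝ) (𝓡 (m + 1)) ∞ (fun t : ℝ => Circle.exp t • p) :=
  π.contMDiff_expAct.comp (contMDiff_id.prodMk contMDiff_const)

omit [IsManifold (𝓡 (m + 1)) ∞ P] [MulAction Circle P] in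
theorem tangentBundle_mk_eq {q p : P} (h : q = p) (w : EuclideanSpace ℝ (Fin (m + 1))) :
    (⟨q, w⟩ : TangentBundle (𝓡 (m + 1)) P) = ⟨p, w⟩ := by
  subst h; rfl

theorem isSmoothField_vert : IsSmoothField π.vert := by
  -- The vertical field is the tangent map of the action `ℝ × P → P` applied to the smooth section
  -- `((0, p), (1, 0))`.
  have h1 : ContMDiff (𝓡 (m + 1)) (𝓘(ℝ, ℝ).prod (𝓡 (m + 1))).tangent ∞
      (fun p : P => (⟨((0 : ℝ), p), ((1 : ℝ), (0 : EuclideanSpace ℝ (Fin (m + 1))))⟩ :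
        TangentBundle (𝓘(ℝ, ℝ).prod (𝓡 (m + 1))) (ℝ × P))) := by
    have h2 : ContMDiff (𝓡 (m + 1)) (𝓘(ℝ, ℝ).tangent.prod (𝓡 (m + 1)).tangent) ∞
        (fun p : P => (((⟨0, (1 : ℝ)⟩ : TangentBundle 𝓘(ℝ, ℝ) ℝ),
          (⟨p, 0⟩ : TangentBundle (𝓡 (m + 1)) P)))) :=
      contMDiff_const.prodMk (IsSmoothField.zero (m := m + 1) (M := P))
    exact contMDiff_equivTangentBundleProd_symm.comp h2
  have h3 := (π.contMDiff_expAct.contMDiff_tangentMap (m := ∞) (by simp)).comp h1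
  refine h3.congr fun p => ?_
  have h4 : mfderiv 𝓘(ℝ, ℝ) (𝓡 (m + 1)) (fun t : ℝ => Circle.exp t • p) 0 (1 : ℝ) =
      mfderiv (𝓘(ℝ, ℝ).prod (𝓡 (m + 1))) (𝓡 (m + 1)) (fun q : ℝ × P => Circle.exp q.1 • q.2)
        ((0 : ℝ), p) ((1 : ℝ), (0 : EuclideanSpace ℝ (Fin (m + 1)))) := by
    have hi : MDifferentiableAt 𝓘(ℝ, ℝ) (𝓘(ℝ, ℝ).prod (𝓡 (m + 1))) (fun t : ℝ => (t, p)) 0 :=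
      mdifferentiableAt_id.prodMk mdifferentiableAt_const
    have := mfderiv_comp_apply (0 : ℝ) (g := fun q : ℝ × P => Circle.exp q.1 • q.2)
      (π.contMDiff_expAct.mdifferentiable (by simp) ((0 : ℝ), p)) hi (1 : ℝ)
    refine this.trans ?_
    rw [mfderiv_prod_left]
    rfl
  have h5 : Circle.exp 0 • p = p := by simp
  refine (tangentBundle_mk_eq h5.symm _).trans ?_
  exact congrArg (fun w : EuclideanSpace ℝ (Fin (m + 1)) =>
    (⟨Circle.exp 0 • p, w⟩ : TangentBundle (𝓡 (m + 1)) P)) h4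

theorem hasDerivAt_orbit {F : Type*} [NormedAddCommGroup F] [NormedSpace ℝ F] {f : P → F} {p : P}
    (hf : MDifferentiableAt (𝓡 (m + 1)) 𝓘(ℝ, F) f p) :
    HasDerivAt (fun t : ℝ => f (Circle.exp t • p)) (mvfderiv (𝓡 (m + 1)) f p (π.vert p)) 0 := by
  have hp : Circle.exp 0 • p = p := by simp
  have key : ∀ q : P, q = p → MDifferentiableAt (𝓡 (m + 1)) 𝓘(ℝ, F) f q ∧
      (∀ w : EuclideanSpace ℝ (Fin (m + 1)), mvfderiv (𝓡 (m + 1)) f q w =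
        mvfderiv (𝓡 (m + 1)) f p w) := by
    rintro q rfl; exact ⟨hf, fun _ => rfl⟩
  obtain ⟨h1, h2⟩ := key _ hp
  have ho := π.contMDiff_orbit p |>.mdifferentiable (by simp) 0
  have h3 : MDifferentiableAt 𝓘(ℝ, ℝ) 𝓘(ℝ, F) (fun t : ℝ => f (Circle.exp t • p)) 0 :=
    MDifferentiableAt.comp (0 : ℝ) (g := f) h1 ho
  have h4 := mfderiv_comp_apply (0 : ℝ) (g := f) h1 ho (1 : ℝ)
  have h5 := h3.differentiableAt.hasDerivAt
  convert h5 using 1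
  refine (h2 _).symm.trans (h4.symm.trans ?_)
  rw [mfderiv_eq_fderiv]
  rfl

end Vertical

variable {π : PrincipalCircleBundle m B P}

namespace ConnectionForm

variable (A : π.ConnectionForm)

/-- The real one-form `-i A`. -/
noncomputable def im (p : P) : TangentSpace (𝓡 (m + 1)) p →L[ℝ] ℝ :=
  Complex.imCLM.comp (A.toFun p)

theorem toFun_eq (p : P) (u : TangentSpace (𝓡 (m + 1)) p) :
    A.toFun p u = A.im p u * Complex.I := by
  apply Complex.ext <;> simp [im, A.re_eq_zero]

@[simp] theorem im_vert (p : P) : A.im p (π.vert p) = 1 := by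
  simp [im, A.vert_eq]

@[simp] theorem im_lift (X : VField m B) (p : P) : A.im p (A.lift X p) = 0 := by
  simp [im, (A.lift_spec X p).1]

@[simp] theorem dproj_lift (X : VField m B) (p : P) :
    π.dproj p (A.lift X p) = X (π.proj p) := (A.lift_spec X p).2

/-- The difference of the two vectors is a horizontal lift of zero, and lifts are unique. Identities
between fields on `P` can thus be checked on the vertical component and on the projection
separately. -/
theorem ext_vec {p : P} {u w : TangentSpace (𝓡 (m + 1)) p} (h1 : A.im p u = A.im p w)
    (h2 : π.dproj p u = π.dproj p w) : u = w := by
  have h := (A.existsUnique_lift p 0).unique (y₁ := u - w) (y₂ := 0)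
    ⟨by rw [A.toFun_eq, map_sub, h1]; simp, by rw [map_sub, h2, sub_self]⟩ (by simp)
  exact sub_eq_zero.1 h

theorem eq_lift_add {U : VField (m + 1) P} {X : VField m B} {f : P → ℝ}
    (h1 : ∀ p, A.im p (U p) = f p) (h2 : ∀ p, π.dproj p (U p) = X (π.proj p)) :
    U = A.lift X + f • π.vert := by
  funext p
  refine A.ext_vec ?_ ?_
  · simp [h1]
  · simp [h2, π.dproj_vert]

theorem lift_add (X Y : VField m B) : A.lift (X + Y) = A.lift X + A.lift Y := by
  funext p; exact A.ext_vec (by simp) (by simp)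

theorem lift_neg (X : VField m B) : A.lift (-X) = -A.lift X := by
  funext p; exact A.ext_vec (by simp) (by simp)

theorem lift_sub (X Y : VField m B) : A.lift (X - Y) = A.lift X - A.lift Y := by
  funext p; exact A.ext_vec (by simp) (by simp)

theorem lift_smul (f : B → ℝ) (X : VField m B) :
    A.lift (f • X) = (fun p => f (π.proj p)) • A.lift X := by
  funext p; exact A.ext_vec (by simp) (by simp)

theorem lift_zero : A.lift 0 = 0 := by
  funext p; exact A.ext_vec (by simp) (by simp)

theorem isSmoothField_lift {X : VField m B} (hX : IsSmoothField X) :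
    IsSmoothField (A.lift X) := by
  intro p
  obtain ⟨U, e, hU, hb, hs, ht, he, he', hfst, -⟩ := π.exists_trivialization (π.proj p)
  have hpe : p ∈ e.source := by rw [hs]; exact hb
  have hsrc : e.source ∈ nhds p := e.open_source.mem_nhds hpe
  have hdiff : e.MDifferentiable (𝓡 (m + 1)) ((𝓡 m).prod (𝓡 1)) :=
    ⟨he.mdifferentiableOn (by simp), he'.mdifferentiableOn (by simp)⟩
  -- In a trivialization, `(X, 0)` is a smooth field over `X`. Its pullback `W` projects to `X`, and
  -- subtracting `α(W) v` makes it horizontal without losing smoothness.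
  let X' : Π y : B × Circle, TangentSpace ((𝓡 m).prod (𝓡 1)) y :=
    fun y => (X y.1, (0 : EuclideanSpace ℝ (Fin 1)))
  have hX' : ContMDiff ((𝓡 m).prod (𝓡 1)) ((𝓡 m).prod (𝓡 1)).tangent ∞
      (fun y : B × Circle => (⟨y, X' y⟩ : TangentBundle ((𝓡 m).prod (𝓡 1)) (B × Circle))) := by
    have h0 : ContMDiff (𝓡 1) (𝓡 1).tangent ∞
        (fun z : Circle => (⟨z, 0⟩ : TangentBundle (𝓡 1) Circle)) :=
      Bundle.contMDiff_zeroSection ℝ (TangentSpace (𝓡 1) : Circle → Type _)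
    have h2 : ContMDiff ((𝓡 m).prod (𝓡 1)) ((𝓡 m).tangent.prod (𝓡 1).tangent) ∞
        (fun y : B × Circle => (((⟨y.1, X y.1⟩ : TangentBundle (𝓡 m) B),
          (⟨y.2, 0⟩ : TangentBundle (𝓡 1) Circle)))) :=
      (ContMDiff.comp hX contMDiff_fst).prodMk (h0.comp contMDiff_snd)
    exact contMDiff_equivTangentBundleProd_symm.comp h2
  let W : VField (m + 1) P := VectorField.mpullback (𝓡 (m + 1)) ((𝓡 m).prod (𝓡 1)) e X'
  have hW : ContMDiffAt (𝓡 (m + 1)) (𝓡 (m + 1)).tangent ∞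
      (fun q : P => (⟨q, W q⟩ : TangentBundle (𝓡 (m + 1)) P)) p :=
    ContMDiffAt.mpullback_vectorField_preimage (n := ∞) (hX' (e p)) (he.contMDiffAt hsrc)
      ⟨hdiff.mfderiv hpe, rfl⟩ (by simp)
  have hdW : ∀ q ∈ e.source, π.dproj q (W q) = X (π.proj q) := by
    intro q hq
    have h1 : (fun q => (e q).1) =ᶠ[nhds q] π.proj := by
      filter_upwards [e.open_source.mem_nhds hq] with q' hq' using hfst q' hq'
    have h2 := mfderiv_comp_apply q (g := (Prod.fst : B × Circle → B)) (I' := (𝓡 m).prod (𝓡 1))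
      (I'' := 𝓡 m) mdifferentiableAt_fst (hdiff.mdifferentiableAt hq) (W q)
    have h3 : mfderiv (𝓡 (m + 1)) ((𝓡 m).prod (𝓡 1)) e q (W q) = X' (e q) := by
      change (mfderiv (𝓡 (m + 1)) ((𝓡 m).prod (𝓡 1)) e q)
        ((mfderiv (𝓡 (m + 1)) ((𝓡 m).prod (𝓡 1)) e q).inverse (X' (e q))) = X' (e q)
      have hinv : (mfderiv (𝓡 (m + 1)) ((𝓡 m).prod (𝓡 1)) e q).IsInvertible :=
        ⟨hdiff.mfderiv hq, rfl⟩
      exact hinv.self_apply_inverse _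
    rw [h3, mfderiv_fst] at h2
    have h4 : mfderiv (𝓡 (m + 1)) (𝓡 m) (Prod.fst ∘ e) q = π.dproj q := h1.mfderiv_eq
    rw [h4] at h2
    refine h2.trans ?_
    change X (e q).1 = X (π.proj q)
    rw [hfst q hq]
  have ha : ContMDiffAt (𝓡 (m + 1)) 𝓘(ℝ, ℝ) ∞ (fun q => A.im q (W q)) p :=
    Complex.imCLM.contMDiff.contMDiffAt.comp p (A.smooth.contMDiffAt.comp p hW)
  have hfin := ContMDiffAt.sub_section hW (ContMDiffAt.smul_section ha (π.isSmoothField_vert p))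
  refine hfin.congr_of_eventuallyEq ?_
  filter_upwards [hsrc] with q hq
  congr 1
  refine A.ext_vec ?_ ?_
  · simp
  · simp [hdW q hq, π.dproj_vert]

theorem lift_smul_point (X : VField m B) (z : Circle) (p : P) :
    A.lift X (z • p) = mfderiv (𝓡 (m + 1)) (𝓡 (m + 1)) (fun q : P => z • q) p (A.lift X p) := by
  refine (A.existsUnique_lift (z • p) (X (π.proj (z • p)))).unique (A.lift_spec X _) ⟨?_, ?_⟩
  · rw [A.invariant, (A.lift_spec X p).1]
  · have h1 : ∀ b b' : B, b = b' →
        (X b : EuclideanSpace ℝ (Fin m)) = X b' := by rintro b _ rfl; rfl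
    exact (π.dproj_smul z p _).trans ((A.dproj_lift X p).trans (h1 _ _ (π.proj_smul z p).symm))

theorem mvfderiv_proj_lift {f : B → ℝ} (hf : ContMDiff (𝓡 m) 𝓘(ℝ, ℝ) ∞ f) (X : VField m B)
    (p : P) : mvfderiv (𝓡 (m + 1)) (fun q => f (π.proj q)) p (A.lift X p) =
      mvfderiv (𝓡 m) f (π.proj p) (X (π.proj p)) := by
  rw [π.mvfderiv_comp_proj p (hf.mdifferentiable (by simp) _), A.dproj_lift]

theorem _root_.KaluzaKlein.PrincipalCircleBundle.mvfderiv_proj_vert {f : B → ℝ}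
    (hf : ContMDiff (𝓡 m) 𝓘(ℝ, ℝ) ∞ f) (p : P) :
    mvfderiv (𝓡 (m + 1)) (fun q => f (π.proj q)) p (π.vert p) = 0 := by
  rw [π.mvfderiv_comp_proj p (hf.mdifferentiable (by simp) _), π.dproj_vert, map_zero]

/-- The invariance of lifts is exploited without flows. The bracket projects to `[X, 0] = 0`, hence
is a multiple of `v`; that multiple is detected by the circle coordinate `f` of a trivialization.
Equivariant functions are multiplied by `i` under `v`, and both `f` and `X̂ f` are equivariant, so
`X̂ (v f)` and `v (X̂ f)` agree. -/
theorem bracket_lift_vert [T2Space B] [T2Space P] {X : VField m B} (hX : IsSmoothField X) :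
    bracket (A.lift X) π.vert = 0 := by
  funext p
  have hXs := A.isSmoothField_lift hX
  have hv := π.isSmoothField_vert
  obtain ⟨U, e, hU, hb, hs, ht, he, -, -, hequiv⟩ := π.exists_trivialization (π.proj p)
  have hpe : p ∈ e.source := by rw [hs]; exact hb
  have hinv : ∀ z : Circle, ∀ q ∈ e.source, z • q ∈ e.source := by
    intro z q hq
    rw [hs] at hq ⊢
    simpa [π.proj_smul] using hq
  let f : P → ℂ := fun q => ((e q).2 : ℂ)
  have hf : ContMDiffOn (𝓡 (m + 1)) 𝓘(ℝ, ℂ) ∞ f e.source := by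
    have : Fact (Module.finrank ℝ ℂ = 1 + 1) := finrank_real_complex_fact'
    have h1 : ContMDiff (𝓡 1) 𝓘(ℝ, ℂ) ∞ (fun z : Circle => (z : ℂ)) := contMDiff_coe_sphere
    exact (h1.comp contMDiff_snd).comp_contMDiffOn he
  have hat : ∀ {g : P → ℂ}, ContMDiffOn (𝓡 (m + 1)) 𝓘(ℝ, ℂ) ∞ g e.source → ∀ q ∈ e.source,
      MDifferentiableAt (𝓡 (m + 1)) 𝓘(ℝ, ℂ) g q := fun hg q hq =>
    (hg.contMDiffAt (e.open_source.mem_nhds hq)).mdifferentiableAt (by simp)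
  have hfz : ∀ (z : Circle), ∀ q ∈ e.source, f (z • q) = z * f q := by
    intro z q hq
    simp [f, hequiv z q hq]
  have hderiv : ∀ {g : P → ℂ}, ContMDiffOn (𝓡 (m + 1)) 𝓘(ℝ, ℂ) ∞ g e.source →
      (∀ (z : Circle), ∀ q ∈ e.source, g (z • q) = z * g q) → ∀ q ∈ e.source,
      mvfderiv (𝓡 (m + 1)) g q (π.vert q) = Complex.I * g q := by
    intro g hg hgz q hq
    have h1 := π.hasDerivAt_orbit (hat hg q hq)
    have h2 : (fun t : ℝ => g (Circle.exp t • q)) =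
        fun t : ℝ => Complex.exp (t * Complex.I) * g q := by
      funext t; rw [hgz _ q hq, Circle.coe_exp]
    rw [h2] at h1
    have h3 : HasDerivAt (fun t : ℝ => Complex.exp (t * Complex.I) * g q)
        (Complex.exp ((0 : ℝ) * Complex.I) * (1 * Complex.I) * g q) 0 :=
      (((hasDerivAt_id (0 : ℝ)).ofReal_comp.mul_const Complex.I).cexp).mul_const (g q)
    simpa using h1.unique h3
  let G : P → ℂ := fun q => mvfderiv (𝓡 (m + 1)) f q (A.lift X q)
  have hG : ContMDiffOn (𝓡 (m + 1)) 𝓘(ℝ, ℂ) ∞ G e.source :=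
    contMDiffOn_mvfderiv_apply e.open_source hf hXs
  have hconst : ∀ (c : ℂ), ∀ q ∈ e.source, ∀ w : TangentSpace (𝓡 (m + 1)) q,
      mvfderiv (𝓡 (m + 1)) (fun q => c * f q) q w = c * mvfderiv (𝓡 (m + 1)) f q w := by
    intro c q hq w
    have h1 := mfderiv_comp_apply q (g := fun y : ℂ => c * y) (I' := 𝓘(ℝ, ℂ)) (I'' := 𝓘(ℝ, ℂ))
      (f := f) ((ContinuousLinearMap.mul ℝ ℂ c).differentiableAt.mdifferentiableAt) (hat hf q hq) w
    refine h1.trans ?_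
    have h2 : mfderiv 𝓘(ℝ, ℂ) 𝓘(ℝ, ℂ) (fun y : ℂ => c * y) (f q) =
        ContinuousLinearMap.mul ℝ ℂ c := by
      rw [mfderiv_eq_fderiv]
      exact (ContinuousLinearMap.mul ℝ ℂ c).fderiv
    rw [h2]
    rfl
  have hGz : ∀ (z : Circle), ∀ q ∈ e.source, G (z • q) = z * G q := by
    intro z q hq
    simp only [G]
    rw [A.lift_smul_point, ← hconst z q hq]
    have h1 := mfderiv_comp_apply q (g := f) (f := fun q : P => z • q) (I' := 𝓡 (m + 1))
      (I'' := 𝓘(ℝ, ℂ)) (hat hf _ (hinv z q hq)) ((π.contMDiff_smul z).mdifferentiable (by simp) q)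
      (A.lift X q)
    refine h1.symm.trans (mvfderiv_congr (f := f ∘ fun q : P => z • q) ?_ _)
    filter_upwards [e.open_source.mem_nhds hq] with q' hq' using hfz z q' hq'
  have hbr := mvfderiv_bracket e.open_source hf hXs hv hpe
  have hvf : (fun y => mvfderiv (𝓡 (m + 1)) f y (π.vert y)) =ᶠ[nhds p]
      fun y => Complex.I * f y := by
    filter_upwards [e.open_source.mem_nhds hpe] with q hq using hderiv hf hfz q hq
  rw [mvfderiv_congr hvf, hconst _ p hpe, hderiv hG hGz p hpe] at hbr
  have hzero : mvfderiv (𝓡 (m + 1)) f p (bracket (A.lift X) π.vert p) = 0 := by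
    rw [hbr]; exact sub_self _
  have hproj : π.dproj p (bracket (A.lift X) π.vert p) = 0 := by
    have := mfderiv_bracket_of_related π.proj_smooth hXs hv hX IsSmoothField.zero
      (A.dproj_lift X) π.dproj_vert p
    refine this.trans ?_
    rw [show bracket X 0 = 0 from VectorField.mlieBracket_zero_right]
    rfl
  -- Since `v f = i f` is nowhere zero, a multiple of `v` that annihilates `f` is zero.
  have hc : bracket (A.lift X) π.vert p =
      A.im p (bracket (A.lift X) π.vert p) • π.vert p :=
    A.ext_vec (by simp) (by simp [hproj, π.dproj_vert])
  rw [hc, map_smul, hderiv hf hfz p hpe] at hzero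
  have hne : Complex.I * f p ≠ 0 := mul_ne_zero Complex.I_ne_zero (Circle.coe_ne_zero _)
  rw [hc, (smul_eq_zero.1 hzero).resolve_right hne, zero_smul]
  rfl

theorem dproj_bracket_lift [T2Space B] [T2Space P] {X Y : VField m B} (hX : IsSmoothField X)
    (hY : IsSmoothField Y) (p : P) :
    π.dproj p (bracket (A.lift X) (A.lift Y) p) = bracket X Y (π.proj p) :=
  mfderiv_bracket_of_related π.proj_smooth (A.isSmoothField_lift hX) (A.isSmoothField_lift hY)
    hX hY (A.dproj_lift X) (A.dproj_lift Y) p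

end ConnectionForm

end PrincipalCircleBundle

end Bundles

end KaluzaKlein

/-! ### Sasakian identities on the base. -/

namespace KaluzaKlein

section SasakianLemmas

variable {m : ℕ} {M : Type*} [TopologicalSpace M] [ChartedSpace (EuclideanSpace ℝ (Fin m)) M]
  [IsManifold (𝓡 m) ∞ M]

theorem OneForm.contMDiff_apply (θ : OneForm m M) {X : VField m M} (hX : IsSmoothField X) :
    ContMDiff (𝓡 m) 𝓘(ℝ, ℝ) ∞ (fun x => θ.toFun x (X x)) :=
  θ.smooth.comp hX

namespace AlmostContactMetric

variable (S : AlmostContactMetric m M)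

theorem isSymmBilin_g : IsSymmBilin S.g where
  symm x u w := S.riem.symm x u w
  add_left x u u' w := by simp [g]
  smul_left x c u w := by simp [g]

theorem eq_of_g_eq {x : M} {u u' : TangentSpace (𝓡 m) x} (h : ∀ w, S.g x u w = S.g x u' w) :
    u = u' := by
  by_contra hne
  have h1 := S.riem.pos x (u - u') (sub_ne_zero.2 hne)
  have h2 : S.g x (u - u') (u - u') = 0 := by
    rw [S.isSymmBilin_g.sub_left, h, sub_self]
  exact h1.ne' h2

theorem ξ_ne_zero (x : M) : S.ξ x ≠ 0 := by
  intro h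
  have := S.η_ξ x
  rw [h, map_zero] at this
  exact zero_ne_one this

-- As `φ²ξ = 0`, evaluating `φ²` on `φξ` gives `φξ = c ξ` with `c = η(φξ)`. Then `c² ξ = φ²ξ = 0`
-- forces `c = 0`.
@[simp] theorem φ_ξ (x : M) : S.φ x (S.ξ x) = 0 := by
  have h1 : S.φ x (S.φ x (S.ξ x)) = 0 := by rw [S.φ_φ, S.η_ξ]; simp
  have h2 := S.φ_φ x (S.φ x (S.ξ x))
  rw [h1, map_zero] at h2
  have h3 : S.φ x (S.ξ x) = S.η.toFun x (S.φ x (S.ξ x)) • S.ξ x := by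
    rw [eq_comm, neg_add_eq_zero] at h2; exact h2
  set c := S.η.toFun x (S.φ x (S.ξ x)) with hc
  have h4 : c • c • S.ξ x = 0 := by rw [← h3, ← map_smul, ← h3, h1]
  have h5 : c = 0 := by
    rcases smul_eq_zero.1 h4 with h | h
    · exact h
    · exact (smul_eq_zero.1 h).resolve_right (S.ξ_ne_zero x)
  rw [h3, h5, zero_smul]

-- Computing `φ³u` as `φ²(φu)` and as `φ(φ²u)` gives results that differ by `η(φu) ξ`.
@[simp] theorem η_φ (x : M) (u : TangentSpace (𝓡 m) x) : S.η.toFun x (S.φ x u) = 0 := by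
  have h1 := S.φ_φ x (S.φ x u)
  have h2 := congrArg (S.φ x) (S.φ_φ x u)
  rw [map_add, map_neg, map_smul, S.φ_ξ, smul_zero, add_zero] at h2
  rw [h1] at h2
  exact (smul_eq_zero.1 (add_eq_left.1 h2)).resolve_right (S.ξ_ne_zero x)

theorem g_φ_φ (x : M) (u w : TangentSpace (𝓡 m) x) :
    S.g x (S.φ x u) (S.φ x w) = S.g x u w - S.η.toFun x u * S.η.toFun x w := by
  have := S.riem_eq x u w
  simp only [g]
  linarith

@[simp] theorem g_ξ_right (x : M) (u : TangentSpace (𝓡 m) x) : S.g x u (S.ξ x) = S.η.toFun x u := by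
  have h := S.g_φ_φ x u (S.ξ x)
  rw [S.φ_ξ, S.isSymmBilin_g.zero_right, S.η_ξ] at h
  linarith

/-- The field `φ X`. -/
noncomputable def φField (X : VField m M) : VField m M := fun x => S.φ x (X x)

theorem isSmoothField_φField {X : VField m M} (hX : IsSmoothField X) :
    IsSmoothField (S.φField X) := S.φ_smooth.comp hX

/-- Stated for fields along a map `b`, so that it applies to the projections of fields on `P` to the
base. -/
theorem contMDiff_g {N : Type*} {k : ℕ} [TopologicalSpace N]
    [ChartedSpace (EuclideanSpace ℝ (Fin k)) N] {b : N → M} (hb : ContMDiff (𝓡 k) (𝓡 m) ∞ b)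
    {u w : Π q : N, TangentSpace (𝓡 m) (b q)}
    (hu : ContMDiff (𝓡 k) (𝓡 m).tangent ∞ (fun q => (⟨b q, u q⟩ : TangentBundle (𝓡 m) M)))
    (hw : ContMDiff (𝓡 k) (𝓡 m).tangent ∞ (fun q => (⟨b q, w q⟩ : TangentBundle (𝓡 m) M))) :
    ContMDiff (𝓡 k) 𝓘(ℝ, ℝ) ∞ (fun q => S.g (b q) (u q) (w q)) := by
  have h1 := ContMDiff.clm_bundle_apply (F₁ := EuclideanSpace ℝ (Fin m))
    (F₂ := EuclideanSpace ℝ (Fin m) →L[ℝ] ℝ)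
    (E₁ := (TangentSpace (𝓡 m) : M → Type _)) (E₂ := fun x : M => TangentSpace (𝓡 m) x →L[ℝ] ℝ)
    (ϕ := fun q => S.riem.inner (b q)) (S.riem.contMDiff.comp hb) hu
  have h2 := ContMDiff.clm_bundle_apply (F₁ := EuclideanSpace ℝ (Fin m)) (F₂ := ℝ)
    (E₁ := (TangentSpace (𝓡 m) : M → Type _)) (E₂ := Bundle.Trivial M ℝ)
    (ϕ := fun q => S.riem.inner (b q) (u q)) h1 hw
  intro q
  exact (Bundle.contMDiffAt_totalSpace.1 (h2 q)).2

theorem contMDiff_g_fields {X Y : VField m M} (hX : IsSmoothField X) (hY : IsSmoothField Y) :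
    ContMDiff (𝓡 m) 𝓘(ℝ, ℝ) ∞ (fun x => S.g x (X x) (Y x)) :=
  S.contMDiff_g contMDiff_id hX hY

variable {S} {nabla : TangentConnection m M}

/-- The formula for `∇φ` at `ξ` reads `-φ(∇_X ξ) = η(X) ξ - X`. Applying `φ` recovers `∇_X ξ`,
because `|ξ| = 1` makes it orthogonal to `ξ`. -/
theorem IsSasakian.covDeriv_ξ (hS : S.IsSasakian nabla) (hn : IsLeviCivita S.g nabla)
    {X : VField m M} (hX : IsSmoothField X) : covDeriv nabla X S.ξ = -S.φField X := by
  funext x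
  have h1 := hS.nabla_φ X S.ξ hX S.ξ_smooth x
  have h2 : (fun y => S.φ y (S.ξ y)) = (0 : VField m M) := by funext y; exact S.φ_ξ y
  rw [h2, covDeriv_zero, S.g_ξ_right, S.η_ξ, one_smul] at h1
  have h3 : S.η.toFun x (covDeriv nabla X S.ξ x) = 0 := by
    have h4 := hn.mvfderiv_metric S.ξ_smooth S.ξ_smooth X x
    have h5 : (fun y => S.g y (S.ξ y) (S.ξ y)) = fun _ => (1 : ℝ) := by
      funext y; rw [S.g_ξ_right, S.η_ξ]
    rw [h5, mvfderiv_const, S.isSymmBilin_g.symm x (S.ξ x), S.g_ξ_right] at h4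
    have h6 : (0 : ℝ) = S.η.toFun x (covDeriv nabla X S.ξ x) +
        S.η.toFun x (covDeriv nabla X S.ξ x) := h4
    linarith
  have h7 := congrArg (S.φ x) h1
  rw [map_sub, map_sub, S.φ_φ, h3, map_smul, S.φ_ξ] at h7
  simp only [Pi.zero_apply, map_zero, zero_smul, add_zero, smul_zero, zero_sub, neg_neg] at h7
  exact h7

theorem IsSasakian.η_covDeriv (hS : S.IsSasakian nabla) (hn : IsLeviCivita S.g nabla)
    {X Z : VField m M} (hX : IsSmoothField X) (hZ : IsSmoothField Z)
    (hZξ : ∀ x, S.g x (Z x) (S.ξ x) = 0) (x : M) :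
    S.η.toFun x (covDeriv nabla X Z x) = S.g x (S.φ x (X x)) (Z x) := by
  have h4 := hn.mvfderiv_metric hZ S.ξ_smooth X x
  have h5 : (fun y => S.g y (Z y) (S.ξ y)) = fun _ => (0 : ℝ) := funext hZξ
  rw [h5, mvfderiv_const, hS.covDeriv_ξ hn hX, S.g_ξ_right, Pi.neg_apply,
    S.isSymmBilin_g.neg_right, S.isSymmBilin_g.symm x (Z x)] at h4
  have h6 : (0 : ℝ) = S.η.toFun x (covDeriv nabla X Z x) - S.g x (S.φ x (X x)) (Z x) := h4
  linarith

theorem IsSasakian.two_dη (hS : S.IsSasakian nabla) {X Y : VField m M} (hX : IsSmoothField X)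
    (hY : IsSmoothField Y) (x : M) :
    mvfderiv (𝓡 m) (fun y => S.η.toFun y (Y y)) x (X x) -
      mvfderiv (𝓡 m) (fun y => S.η.toFun y (X y)) x (Y x) - S.η.toFun x (bracket X Y x) =
      -2 * S.g x (S.φ x (X x)) (Y x) := by
  rw [hS.kContact.contact X Y hX hY x]
  have : S.η.d X Y x = (1 / 2) * (mvfderiv (𝓡 m) (fun y => S.η.toFun y (Y y)) x (X x) -
      mvfderiv (𝓡 m) (fun y => S.η.toFun y (X y)) x (Y x) - S.η.toFun x (bracket X Y x)) := rfl
  rw [this]; ring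

/-- The transverse derivative in terms of the Levi-Civita connection. -/
theorem IsSasakian.transverseDeriv_eq (hS : S.IsSasakian nabla) (hn : IsLeviCivita S.g nabla)
    {X Z : VField m M} (hX : IsSmoothField X) (hZ : IsSmoothField Z)
    (hZξ : ∀ x, S.g x (Z x) (S.ξ x) = 0) :
    transverseDeriv S.g nabla S.ξ X Z =
      covDeriv nabla X Z - (fun x => S.g x (S.φ x (X x)) (Z x)) • S.ξ
        + (fun x => S.η.toFun x (X x)) • S.φField Z := by
  have hp : ∀ W : VField m M, orthProj S.g S.ξ W = W - (fun x => S.η.toFun x (W x)) • S.ξ := by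
    intro W; funext x
    simp only [orthProj, S.g_ξ_right, S.η_ξ, div_one]
    rfl
  have hξs : IsSmoothField S.ξ := S.ξ_smooth
  have hηX := S.η.contMDiff_apply hX
  -- The bracket in the `ξ` direction differs from `∇_ξ Z` by `-∇_Z ξ = φZ`; this is the source of
  -- the term `η(X) φZ`.
  have hlie : bracket S.ξ Z = covDeriv nabla S.ξ Z + S.φField Z := by
    rw [← hn.covDeriv_sub_covDeriv hξs hZ, hS.covDeriv_ξ hn hZ, sub_neg_eq_add]
  funext x
  simp only [transverseDeriv, hp, covDeriv_sub_left, covDeriv_smul_left, hlie,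
    S.g_ξ_right, S.η_ξ, div_one, Pi.sub_apply, Pi.add_apply, Pi.smul_apply', map_sub, map_add,
    map_smul, hS.η_covDeriv hn hX hZ hZξ, hS.η_covDeriv hn hξs hZ hZξ, S.φ_ξ, φField, S.η_φ,
    S.isSymmBilin_g.zero_left, smul_eq_mul, mul_zero, sub_zero, zero_smul, add_zero]
  module

end AlmostContactMetric

end SasakianLemmas

end KaluzaKlein

/-! ### Flat forms plus pullbacks, and the Kaluza-Klein metric. -/

namespace KaluzaKlein

namespace PrincipalCircleBundle

variable {m : ℕ} {B P : Type*}
  [TopologicalSpace B] [ChartedSpace (EuclideanSpace ℝ (Fin m)) B] [IsManifold (𝓡 m) ∞ B]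
  [TopologicalSpace P] [ChartedSpace (EuclideanSpace ℝ (Fin (m + 1))) P]
  [IsManifold (𝓡 (m + 1)) ∞ P] [MulAction Circle P] {π : PrincipalCircleBundle m B P}

namespace ConnectionForm

section Bracket

variable (A₀ : π.ConnectionForm) (θ : OneForm m B)

theorem im_addPullback (p : P) (u : TangentSpace (𝓡 (m + 1)) p) :
    (A₀.addPullback θ).im p u = A₀.im p u + θ.toFun (π.proj p) (π.dproj p u) := by
  simp [im, addPullback]

theorem lift_addPullback (X : VField m B) :
    (A₀.addPullback θ).lift X =
      A₀.lift X - (fun p => θ.toFun (π.proj p) (X (π.proj p))) • π.vert := by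
  funext p
  refine (A₀.addPullback θ).ext_vec ?_ ?_
  · rw [im_lift, im_addPullback]
    simp [π.dproj_vert]
  · simp [π.dproj_vert]

/-- The vertical part of the bracket of two lifts, for the sum of a flat connection form and the
pullback of a 1-form. -/
theorem im_bracket_lift_addPullback [T2Space B] [T2Space P] (hA₀ : A₀.IsFlat) {X Y : VField m B}
    (hX : IsSmoothField X) (hY : IsSmoothField Y) (p : P) :
    (A₀.addPullback θ).im p (bracket ((A₀.addPullback θ).lift X) ((A₀.addPullback θ).lift Y) p) =
      -(mvfderiv (𝓡 m) (fun y => θ.toFun y (Y y)) (π.proj p) (X (π.proj p)) -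
        mvfderiv (𝓡 m) (fun y => θ.toFun y (X y)) (π.proj p) (Y (π.proj p)) -
        θ.toFun (π.proj p) (bracket X Y (π.proj p))) := by
  have hXl := A₀.isSmoothField_lift hX
  have hYl := A₀.isSmoothField_lift hY
  have hv := π.isSmoothField_vert
  have hθX := θ.contMDiff_apply hX
  have hθY := θ.contMDiff_apply hY
  have hf : ContMDiff (𝓡 (m + 1)) 𝓘(ℝ, ℝ) ∞ (fun p => θ.toFun (π.proj p) (X (π.proj p))) :=
    hθX.comp π.proj_smooth
  have hg : ContMDiff (𝓡 (m + 1)) 𝓘(ℝ, ℝ) ∞ (fun p => θ.toFun (π.proj p) (Y (π.proj p))) :=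
    hθY.comp π.proj_smooth
  rw [im_addPullback, dproj_bracket_lift _ hX hY, lift_addPullback, lift_addPullback]
  have hflat : A₀.im p (bracket (A₀.lift X) (A₀.lift Y) p) = 0 := by
    have h1 : -A₀.toFun p (bracket (A₀.lift X) (A₀.lift Y) p) = 0 := hA₀ X Y hX hY p
    simp only [im, ContinuousLinearMap.comp_apply]
    rw [neg_eq_zero.1 h1]; simp
  have hright : ∀ (V : VField (m + 1) P) {f : P → ℝ}, ContMDiff (𝓡 (m + 1)) 𝓘(ℝ, ℝ) ∞ f →
      bracket V (f • π.vert) p =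
        mvfderiv (𝓡 (m + 1)) f p (V p) • π.vert p + f p • bracket V π.vert p := fun V f hf =>
    bracket_smul_right (hf.mdifferentiable (by simp) p) (hv.mdifferentiableAt p)
  have hsub : ∀ {U V W : VField (m + 1) P}, IsSmoothField V → IsSmoothField W →
      bracket U (V - W) p = bracket U V p - bracket U W p := by
    intro U V W hV hW
    rw [sub_eq_add_neg, ← neg_one_smul ℝ W]
    refine (VectorField.mlieBracket_add_right (hV.mdifferentiableAt p)
      ((hW.const_smul (-1)).mdifferentiableAt p)).trans ?_
    rw [VectorField.mlieBracket_const_smul_right (hW.mdifferentiableAt p), neg_one_smul,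
      ← sub_eq_add_neg]
  have hswap : ∀ U V : VField (m + 1) P, bracket U V p = -bracket V U p :=
    fun U V => VectorField.mlieBracket_swap_apply
  have hfv := hv.smul hf
  have hgv := hv.smul hg
  have hvv : bracket π.vert π.vert p = 0 :=
    congrFun (VectorField.mlieBracket_self (I := 𝓡 (m + 1)) (V := π.vert)) p
  -- Both lifts have the form `X̂₀ - θ(X) v`. The brackets of `A₀`-lifts with `v` vanish, and
  -- pulled-back functions are constant along `v`, so only `X(θ(Y))` and `Y(θ(X))` survive in the
  -- vertical direction.
  rw [hsub hYl hgv, hswap _ (A₀.lift Y), hsub hXl hfv, hswap (A₀.lift Y) (A₀.lift X),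
    hright _ hf, hright _ hg, A₀.bracket_lift_vert hY, hswap _ π.vert, hsub hXl hfv, hright _ hf,
    hswap π.vert (A₀.lift X), A₀.bracket_lift_vert hX, hvv]
  simp only [Pi.zero_apply, Pi.sub_apply, Pi.smul_apply', map_sub, map_neg, map_add, map_smul,
    A₀.im_vert, hflat, map_zero, A₀.mvfderiv_proj_lift hθX, A₀.mvfderiv_proj_lift hθY,
    mvfderiv_proj_vert hθX, mvfderiv_proj_vert hθY, smul_eq_mul]
  ring

end Bracket

section Metric

variable (A : π.ConnectionForm) (S : AlmostContactMetric m B)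

theorem kkMetric_apply (p : P) (u w : TangentSpace (𝓡 (m + 1)) p) :
    A.kkMetric S.g 1 p u w =
      S.g (π.proj p) (π.dproj p u) (π.dproj p w) - A.im p u * A.im p w := by
  simp only [kkMetric, toFun_eq, Complex.mul_re, Complex.mul_im, Complex.ofReal_re,
    Complex.ofReal_im, Complex.I_re, Complex.I_im]
  ring

theorem isSymmBilin_kkMetric : IsSymmBilin (A.kkMetric S.g 1) where
  symm p u w := by
    rw [kkMetric_apply, kkMetric_apply, S.isSymmBilin_g.symm, mul_comm]
  add_left p u u' w := by
    simp only [kkMetric_apply, map_add, S.isSymmBilin_g.add_left]; ring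
  smul_left p c u w := by
    simp only [kkMetric_apply, map_smul, S.isSymmBilin_g.smul_left, smul_eq_mul]; ring

/-- Pairing with `v` isolates the vertical component; once that is zero, the positive definite
metric on the base detects the rest. -/
theorem kkMetric_nondegenerate (p : P) (u : TangentSpace (𝓡 (m + 1)) p)
    (h : ∀ w, A.kkMetric S.g 1 p u w = 0) : u = 0 := by
  refine A.ext_vec ?_ (S.eq_of_g_eq fun w => ?_)
  · have := h (π.vert p)
    rw [kkMetric_apply, π.dproj_vert, S.isSymmBilin_g.zero_right, A.im_vert] at this
    rw [map_zero]; linarith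
  · obtain ⟨w, rfl⟩ := π.dproj_surjective p w
    have h1 := h (π.vert p)
    rw [kkMetric_apply, π.dproj_vert, S.isSymmBilin_g.zero_right, A.im_vert] at h1
    have h2 := h w
    rw [kkMetric_apply, show A.im p u = 0 by linarith] at h2
    rw [map_zero, S.isSymmBilin_g.zero_left]
    linarith

theorem contMDiff_im {U : VField (m + 1) P} (hU : IsSmoothField U) :
    ContMDiff (𝓡 (m + 1)) 𝓘(ℝ, ℝ) ∞ (fun p => A.im p (U p)) :=
  Complex.imCLM.contMDiff.comp (A.smooth.comp hU)

theorem contMDiff_kkMetric {U V : VField (m + 1) P} (hU : IsSmoothField U)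
    (hV : IsSmoothField V) :
    ContMDiff (𝓡 (m + 1)) 𝓘(ℝ, ℝ) ∞ (fun p => A.kkMetric S.g 1 p (U p) (V p)) := by
  simp only [kkMetric_apply]
  have hT := π.proj_smooth.contMDiff_tangentMap (m := ∞) (by simp)
  exact (S.contMDiff_g π.proj_smooth (hT.comp hU) (hT.comp hV)).sub
    ((A.contMDiff_im hU).mul (A.contMDiff_im hV))

end Metric

end ConnectionForm

end PrincipalCircleBundle

/-- A Kaluza-Klein connection over a Sasakian manifold: the Levi-Civita connection of the
Kaluza-Klein metric of a connection form whose curvature form is `2 dη`. -/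
structure IsSasakianKK {m : ℕ} {B P : Type*}
    [TopologicalSpace B] [ChartedSpace (EuclideanSpace ℝ (Fin m)) B] [IsManifold (𝓡 m) ∞ B]
    [TopologicalSpace P] [ChartedSpace (EuclideanSpace ℝ (Fin (m + 1))) P]
    [IsManifold (𝓡 (m + 1)) ∞ P] [MulAction Circle P] {π : PrincipalCircleBundle m B P}
    (S : AlmostContactMetric m B) (nabla : TangentConnection m B) (A : π.ConnectionForm)
    (D : TangentConnection (m + 1) P) : Prop where
  base : IsLeviCivita S.g nabla
  sasakian : S.IsSasakian nabla
  total : IsLeviCivita (A.kkMetric S.g 1) D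
  im_bracket : ∀ X Y : VField m B, IsSmoothField X → IsSmoothField Y → ∀ p,
    A.im p (bracket (A.lift X) (A.lift Y) p) =
      2 * S.g (π.proj p) (S.φ (π.proj p) (X (π.proj p))) (Y (π.proj p))

/-! ### The Levi-Civita connection of the Kaluza-Klein metric. -/

namespace IsSasakianKK

open PrincipalCircleBundle

variable {m : ℕ} {B P : Type*}
  [TopologicalSpace B] [ChartedSpace (EuclideanSpace ℝ (Fin m)) B] [IsManifold (𝓡 m) ∞ B]
  [TopologicalSpace P] [ChartedSpace (EuclideanSpace ℝ (Fin (m + 1))) P]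
  [IsManifold (𝓡 (m + 1)) ∞ P] [MulAction Circle P] {π : PrincipalCircleBundle m B P}
  [T2Space B] [T2Space P]
  {S : AlmostContactMetric m B} {nabla : TangentConnection m B} {A : π.ConnectionForm}
  {D : TangentConnection (m + 1) P} (K : IsSasakianKK S nabla A D)
include K

theorem bracket_lift {X Y : VField m B} (hX : IsSmoothField X) (hY : IsSmoothField Y) :
    bracket (A.lift X) (A.lift Y) = A.lift (bracket X Y) +
      (fun p => 2 * S.g (π.proj p) (S.φField X (π.proj p)) (Y (π.proj p))) • π.vert :=
  A.eq_lift_add (K.im_bracket X Y hX hY) (A.dproj_bracket_lift hX hY)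

/-- In the Koszul formula tested against `v` only the bracket term survives, which gives half the
vertical part of `[X̂, Ŷ]`. Tested against a lift, it reduces to the Koszul formula of the base. -/
theorem covDeriv_lift_lift {X Y : VField m B} (hX : IsSmoothField X) (hY : IsSmoothField Y) :
    covDeriv D (A.lift X) (A.lift Y) = A.lift (covDeriv nabla X Y) +
      (fun p => S.g (π.proj p) (S.φField X (π.proj p)) (Y (π.proj p))) • π.vert := by
  have hlift : ∀ {X Y : VField m B},
      (fun q => A.kkMetric S.g 1 q (A.lift X q) (A.lift Y q)) =
        fun q => (fun b => S.g b (X b) (Y b)) (π.proj q) := by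
    intro X Y; funext q; rw [A.kkMetric_apply]; simp
  have hlv : ∀ {X : VField m B},
      (fun q => A.kkMetric S.g 1 q (A.lift X q) (π.vert q)) = fun _ => (0 : ℝ) := by
    intro X; funext q
    rw [A.kkMetric_apply, π.dproj_vert, S.isSymmBilin_g.zero_right, A.im_lift]; ring
  have hX' := A.isSmoothField_lift hX
  have hY' := A.isSmoothField_lift hY
  refine A.eq_lift_add (fun p => ?_) (fun p => S.eq_of_g_eq fun w => ?_)
  · have h := K.total.koszul (A.isSymmBilin_kkMetric S) hX' hY' π.isSmoothField_vert p
    rw [hlv, hlv, hlift, mvfderiv_proj_vert (S.contMDiff_g_fields hX hY), mvfderiv_const,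
      A.bracket_lift_vert hX, A.bracket_lift_vert hY] at h
    simp only [A.kkMetric_apply, π.dproj_vert, S.isSymmBilin_g.zero_right, A.im_vert,
      S.isSymmBilin_g.zero_left, map_zero, Pi.zero_apply, K.im_bracket X Y hX hY,
      zero_mul, mul_one, zero_sub] at h
    have h2 : ∀ u : TangentSpace (𝓡 (m + 1)) p, (0 : TangentSpace (𝓡 (m + 1)) p →L[ℝ] ℝ) u = 0 :=
      fun u => rfl
    rw [h2, h2] at h
    simp only [AlmostContactMetric.φField]
    linarith
  · obtain ⟨Z, hZ, rfl⟩ := exists_isSmoothField_eq (π.proj p) w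
    have h := K.total.koszul (A.isSymmBilin_kkMetric S) hX' hY' (A.isSmoothField_lift hZ) p
    have h' := K.base.koszul S.isSymmBilin_g hX hY hZ (π.proj p)
    rw [hlift, hlift, hlift, A.mvfderiv_proj_lift (S.contMDiff_g_fields hY hZ),
      A.mvfderiv_proj_lift (S.contMDiff_g_fields hX hZ),
      A.mvfderiv_proj_lift (S.contMDiff_g_fields hX hY)] at h
    simp only [A.kkMetric_apply, A.im_lift, mul_zero, sub_zero, A.dproj_lift,
      A.dproj_bracket_lift hX hY, A.dproj_bracket_lift hX hZ, A.dproj_bracket_lift hY hZ] at h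
    rw [← h'] at h
    linarith

theorem covDeriv_vert_lift {X : VField m B} (hX : IsSmoothField X) :
    covDeriv D π.vert (A.lift X) = covDeriv D (A.lift X) π.vert := by
  have h := K.total.covDeriv_sub_covDeriv (A.isSmoothField_lift hX) π.isSmoothField_vert
  rw [A.bracket_lift_vert hX] at h
  exact (sub_eq_zero.1 h).symm

omit [T2Space B] [T2Space P] in
theorem im_covDeriv_vert (U : VField (m + 1) P) (p : P) :
    A.im p (covDeriv D U π.vert p) = 0 := by
  have h := K.total.mvfderiv_metric π.isSmoothField_vert π.isSmoothField_vert U p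
  have h1 : (fun q => A.kkMetric S.g 1 q (π.vert q) (π.vert q)) = fun _ => (-1 : ℝ) := by
    funext q
    rw [A.kkMetric_apply, π.dproj_vert, S.isSymmBilin_g.zero_right, A.im_vert]; ring
  rw [h1, mvfderiv_const] at h
  simp only [A.kkMetric_apply, π.dproj_vert, S.isSymmBilin_g.zero_right,
    S.isSymmBilin_g.zero_left, A.im_vert] at h
  have h2 : (0 : ℝ) = 0 - A.im p (covDeriv D U π.vert p) * 1 +
    (0 - 1 * A.im p (covDeriv D U π.vert p)) := h
  linarith

omit [T2Space B] [T2Space P] in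
/-- Pairing `D_U v` with horizontal lifts. -/
theorem g_covDeriv_vert {U : VField (m + 1) P} {Y : VField m B} (hY : IsSmoothField Y) (p : P) :
    S.g (π.proj p) (π.dproj p (covDeriv D U π.vert p)) (Y (π.proj p)) =
      A.im p (covDeriv D U (A.lift Y) p) := by
  have h := K.total.mvfderiv_metric π.isSmoothField_vert (A.isSmoothField_lift hY) U p
  have h1 : (fun q => A.kkMetric S.g 1 q (π.vert q) (A.lift Y q)) = fun _ => (0 : ℝ) := by
    funext q
    rw [A.kkMetric_apply, π.dproj_vert, S.isSymmBilin_g.zero_left, A.im_lift]; ring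
  rw [h1, mvfderiv_const] at h
  simp only [A.kkMetric_apply, π.dproj_vert, S.isSymmBilin_g.zero_left, A.im_vert, A.im_lift,
    A.dproj_lift] at h
  have h2 : (0 : ℝ) = S.g (π.proj p) (π.dproj p (covDeriv D U π.vert p)) (Y (π.proj p)) -
    A.im p (covDeriv D U π.vert p) * 0 + (0 - 1 * A.im p (covDeriv D U (A.lift Y) p)) := h
  linarith

/-- Metricity applied to the constant functions `g̃(v, v) = -1` and `g̃(v, Ŷ) = 0` expresses this
derivative through the vertical part of `D_X̂ Ŷ`. -/
theorem covDeriv_lift_vert {X : VField m B} (hX : IsSmoothField X) :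
    covDeriv D (A.lift X) π.vert = A.lift (S.φField X) := by
  funext p
  refine A.ext_vec (by rw [K.im_covDeriv_vert, A.im_lift]) (S.eq_of_g_eq fun w => ?_)
  obtain ⟨Y, hY, rfl⟩ := exists_isSmoothField_eq (π.proj p) w
  rw [K.g_covDeriv_vert hY, K.covDeriv_lift_lift hX hY]
  simp

theorem covDeriv_vert_lift_eq {X : VField m B} (hX : IsSmoothField X) :
    covDeriv D π.vert (A.lift X) = A.lift (S.φField X) := by
  rw [K.covDeriv_vert_lift hX, K.covDeriv_lift_vert hX]

theorem covDeriv_vert_vert : covDeriv D π.vert π.vert = 0 := by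
  funext p
  refine A.ext_vec (by simp [K.im_covDeriv_vert]) (S.eq_of_g_eq fun w => ?_)
  obtain ⟨Y, hY, rfl⟩ := exists_isSmoothField_eq (π.proj p) w
  rw [K.g_covDeriv_vert hY, K.covDeriv_vert_lift_eq hY, A.im_lift]
  simp [S.isSymmBilin_g.zero_left]

end IsSasakianKK

end KaluzaKlein

/-! ### The parallel field and the curvature identities. -/

namespace KaluzaKlein

namespace IsSasakianKK

open PrincipalCircleBundle

variable {m : ℕ} {B P : Type*}
  [TopologicalSpace B] [ChartedSpace (EuclideanSpace ℝ (Fin m)) B] [IsManifold (𝓡 m) ∞ B]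
  [TopologicalSpace P] [ChartedSpace (EuclideanSpace ℝ (Fin (m + 1))) P]
  [IsManifold (𝓡 (m + 1)) ∞ P] [MulAction Circle P] {π : PrincipalCircleBundle m B P}
  [T2Space B] [T2Space P]
  {S : AlmostContactMetric m B} {nabla : TangentConnection m B} {A : π.ConnectionForm}
  {D : TangentConnection (m + 1) P} (K : IsSasakianKK S nabla A D)

omit [T2Space B] [T2Space P] in
theorem isSmoothField_reeb_add_vert (S : AlmostContactMetric m B) (A : π.ConnectionForm) :
    IsSmoothField (A.lift S.ξ + π.vert) :=
  (A.isSmoothField_lift S.ξ_smooth).add π.isSmoothField_vert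

include K

theorem covDeriv_reeb_add_vert (U : VField (m + 1) P) :
    covDeriv D U (A.lift S.ξ + π.vert) = 0 := by
  have hξ : IsSmoothField S.ξ := S.ξ_smooth
  have hξ' := A.isSmoothField_lift hξ
  have hv := π.isSmoothField_vert
  have hlift : ∀ {X : VField m B}, IsSmoothField X →
      covDeriv D (A.lift X) (A.lift S.ξ + π.vert) = 0 := by
    intro X hX
    rw [covDeriv_add _ hξ' hv, K.covDeriv_lift_lift hX hξ, K.covDeriv_lift_vert hX,
      K.sasakian.covDeriv_ξ K.base hX, A.lift_neg]
    funext p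
    simp [AlmostContactMetric.φField]
  have hvert : covDeriv D π.vert (A.lift S.ξ + π.vert) = 0 := by
    rw [covDeriv_add _ hξ' hv, K.covDeriv_vert_lift_eq hξ, K.covDeriv_vert_vert, add_zero,
      show S.φField S.ξ = 0 from funext S.φ_ξ, A.lift_zero]
  funext p
  -- The derivative depends only on the value of `U` at `p`, which decomposes into a lift and a
  -- multiple of `v`.
  obtain ⟨X, hX, hXp⟩ := exists_isSmoothField_eq (π.proj p) (π.dproj p (U p))
  have hU : U p = A.lift X p + A.im p (U p) • π.vert p :=
    A.ext_vec (by simp) (by simp [hXp, π.dproj_vert])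
  have h1 := congrFun (hlift hX) p
  have h2 := congrFun hvert p
  simp only [covDeriv] at h1 h2 ⊢
  rw [hU, map_add, map_smul, h1, h2]
  simp

/-- The `ξ` component removed from `∇_X Z` by the projection is `g(φX, Z)`, the same coefficient as
that of `v`; together they form a multiple of the parallel field, which is easy to differentiate
again. -/
theorem covDeriv_lift_lift_transverse {X Z : VField m B} (hX : IsSmoothField X)
    (hZ : IsSmoothField Z) (hZξ : ∀ b, S.g b (Z b) (S.ξ b) = 0) :
    covDeriv D (A.lift X) (A.lift Z) =
      A.lift (transverseDeriv S.g nabla S.ξ X Z) +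
        (fun p => S.g (π.proj p) (S.φField X (π.proj p)) (Z (π.proj p))) • (A.lift S.ξ + π.vert) -
        (fun p => S.η.toFun (π.proj p) (X (π.proj p))) • A.lift (S.φField Z) := by
  rw [K.covDeriv_lift_lift hX hZ, K.sasakian.transverseDeriv_eq K.base hX hZ hZξ, A.lift_add,
    A.lift_sub, A.lift_smul, A.lift_smul]
  funext p
  simp only [Pi.add_apply, Pi.sub_apply, Pi.smul_apply', AlmostContactMetric.φField]
  module

theorem curvature_lift_lift_lift {X Y Z : VField m B} (hX : IsSmoothField X)
    (hY : IsSmoothField Y) (hZ : IsSmoothField Z) (hXξ : ∀ b, S.g b (X b) (S.ξ b) = 0)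
    (hYξ : ∀ b, S.g b (Y b) (S.ξ b) = 0) (hZξ : ∀ b, S.g b (Z b) (S.ξ b) = 0) :
    curvature D (A.lift X) (A.lift Y) (A.lift Z) =
      A.lift (transverseCurvature S.g nabla S.ξ X Y Z) := by
  have hr := isSmoothField_reeb_add_vert S A
  have hξ : IsSmoothField S.ξ := S.ξ_smooth
  have hηX : ∀ b, S.η.toFun b (X b) = 0 := fun b => by rw [← S.g_ξ_right, hXξ]
  have hηY : ∀ b, S.η.toFun b (Y b) = 0 := fun b => by rw [← S.g_ξ_right, hYξ]
  have hφX := S.isSmoothField_φField hX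
  have hφY := S.isSmoothField_φField hY
  have hsm : ∀ {V : VField m B}, IsSmoothField V → (∀ b, S.η.toFun b (V b) = 0) →
      IsSmoothField (transverseDeriv S.g nabla S.ξ V Z) ∧
      ∀ b, S.g b (transverseDeriv S.g nabla S.ξ V Z b) (S.ξ b) = 0 := by
    intro V hV hηV
    have h1 : transverseDeriv S.g nabla S.ξ V Z =
        covDeriv nabla V Z - (fun x => S.g x (S.φField V x) (Z x)) • S.ξ := by
      rw [K.sasakian.transverseDeriv_eq K.base hV hZ hZξ]
      funext b
      simp [hηV, AlmostContactMetric.φField]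
    rw [h1]
    refine ⟨(hV.covDeriv K.base.smooth hZ).sub
      (hξ.smul (S.contMDiff_g_fields (S.isSmoothField_φField hV) hZ)), fun b => ?_⟩
    rw [S.g_ξ_right, Pi.sub_apply, map_sub, K.sasakian.η_covDeriv K.base hV hZ hZξ]
    simp [S.η_ξ, AlmostContactMetric.φField]
  -- As `r` is parallel, only its coefficient `g(φV, Z)` is differentiated; this gives the last two
  -- terms, while the first comes from the derivative of the lift of `∇^𝒟_V Z`.
  have hmain : ∀ {U V : VField m B}, IsSmoothField U → IsSmoothField V →
      (∀ b, S.η.toFun b (U b) = 0) → (∀ b, S.η.toFun b (V b) = 0) → ∀ p,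
      covDeriv D (A.lift U) (covDeriv D (A.lift V) (A.lift Z)) p =
        A.lift (transverseDeriv S.g nabla S.ξ U (transverseDeriv S.g nabla S.ξ V Z)) p +
        (S.g (π.proj p) (S.φField U (π.proj p)) (covDeriv nabla V Z (π.proj p)) +
          (S.g (π.proj p) (covDeriv nabla U (S.φField V) (π.proj p)) (Z (π.proj p)) +
            S.g (π.proj p) (S.φField V (π.proj p)) (covDeriv nabla U Z (π.proj p)))) •
          (A.lift S.ξ + π.vert) p := by
    intro U V hU hV hηU hηV p
    have hφV := S.isSmoothField_φField hV
    have h1 : covDeriv D (A.lift V) (A.lift Z) =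
        A.lift (transverseDeriv S.g nabla S.ξ V Z) +
        (fun p => S.g (π.proj p) (S.φField V (π.proj p)) (Z (π.proj p))) •
          (A.lift S.ξ + π.vert) := by
      rw [K.covDeriv_lift_lift_transverse hV hZ hZξ]
      funext p; simp [hηV]
    have hf := S.contMDiff_g_fields hφV hZ
    have hfπ : ContMDiff (𝓡 (m + 1)) 𝓘(ℝ, ℝ) ∞
        (fun p => S.g (π.proj p) (S.φField V (π.proj p)) (Z (π.proj p))) :=
      hf.comp π.proj_smooth
    rw [h1, covDeriv_add _ (A.isSmoothField_lift (hsm hV hηV).1) (hr.smul hfπ),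
      covDeriv_smul _ hfπ hr, K.covDeriv_reeb_add_vert,
      K.covDeriv_lift_lift_transverse hU (hsm hV hηV).1 (hsm hV hηV).2]
    have h2 := A.mvfderiv_proj_lift hf U p
    rw [K.base.mvfderiv_metric hφV hZ] at h2
    have h3 : S.g (π.proj p) (S.φField U (π.proj p))
        (transverseDeriv S.g nabla S.ξ V Z (π.proj p)) =
        S.g (π.proj p) (S.φField U (π.proj p)) (covDeriv nabla V Z (π.proj p)) := by
      rw [K.sasakian.transverseDeriv_eq K.base hV hZ hZξ]
      simp [hηV, S.isSymmBilin_g.sub_right, S.isSymmBilin_g.smul_right,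
        AlmostContactMetric.φField]
    simp only [Pi.add_apply, Pi.sub_apply, Pi.smul_apply', hηU, h2, h3, Pi.zero_apply]
    module
  -- Here `η([X, Y]) = 2 g(φX, Y)`, so the `φZ` term of the lifted bracket cancels against `D_v Ẑ`,
  -- which enters with the same factor.
  have hbr : ∀ p, covDeriv D (bracket (A.lift X) (A.lift Y)) (A.lift Z) p =
      A.lift (transverseDeriv S.g nabla S.ξ (bracket X Y) Z) p +
        S.g (π.proj p) (S.φField (bracket X Y) (π.proj p)) (Z (π.proj p)) •
          (A.lift S.ξ + π.vert) p := by
    intro p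
    rw [K.bracket_lift hX hY, covDeriv_add_left, covDeriv_smul_left, K.covDeriv_vert_lift_eq hZ,
      K.covDeriv_lift_lift_transverse (hX.bracket hY) hZ hZξ]
    have h1 := K.sasakian.two_dη hX hY (π.proj p)
    simp only [hηX, hηY, mvfderiv_const] at h1
    have h2 : (0 : ℝ) - 0 - S.η.toFun (π.proj p) (bracket X Y (π.proj p)) =
      -2 * S.g (π.proj p) (S.φ (π.proj p) (X (π.proj p))) (Y (π.proj p)) := h1
    have h3 : S.η.toFun (π.proj p) (bracket X Y (π.proj p)) =
        2 * S.g (π.proj p) (S.φField X (π.proj p)) (Y (π.proj p)) := by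
      simp only [AlmostContactMetric.φField]; linarith
    simp only [Pi.add_apply, Pi.sub_apply, Pi.smul_apply', h3]
    module
  funext p
  have hb : S.φField (bracket X Y) (π.proj p) =
      S.φ (π.proj p) (covDeriv nabla X Y (π.proj p)) -
        S.φ (π.proj p) (covDeriv nabla Y X (π.proj p)) := by
    rw [← K.base.covDeriv_sub_covDeriv hX hY, ← map_sub]; rfl
  -- The corrections `g(X, Y) ξ` in `∇_X(φY)` and `∇_Y(φX)` cancel by symmetry, so the `r`
  -- coefficients of the three curvature terms add up to zero.
  have hφ : S.g (π.proj p) (covDeriv nabla X (S.φField Y) (π.proj p)) (Z (π.proj p)) -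
      S.g (π.proj p) (covDeriv nabla Y (S.φField X) (π.proj p)) (Z (π.proj p)) =
      S.g (π.proj p) (S.φField (bracket X Y) (π.proj p)) (Z (π.proj p)) := by
    have h1 : covDeriv nabla X (S.φField Y) (π.proj p) - _ = _ :=
      K.sasakian.nabla_φ X Y hX hY (π.proj p)
    have h2 : covDeriv nabla Y (S.φField X) (π.proj p) - _ = _ :=
      K.sasakian.nabla_φ Y X hY hX (π.proj p)
    rw [hηY, zero_smul, sub_zero, sub_eq_iff_eq_add] at h1
    rw [hηX, zero_smul, sub_zero, sub_eq_iff_eq_add, S.isSymmBilin_g.symm] at h2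
    rw [hb, h1, h2, ← S.isSymmBilin_g.sub_left, add_sub_add_left_eq_sub]
  simp only [curvature, transverseCurvature, A.lift_sub, Pi.sub_apply]
  rw [hmain hX hY hηX hηY, hmain hY hX hηY hηX, hbr, ← hφ]
  module

theorem curvature_lift_lift_vert {X Y : VField m B} (hX : IsSmoothField X)
    (hY : IsSmoothField Y) (hXξ : ∀ b, S.g b (X b) (S.ξ b) = 0)
    (hYξ : ∀ b, S.g b (Y b) (S.ξ b) = 0) :
    curvature D (A.lift X) (A.lift Y) π.vert = 0 := by
  have hηX : ∀ b, S.η.toFun b (X b) = 0 := fun b => by rw [← S.g_ξ_right, hXξ]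
  have hηY : ∀ b, S.η.toFun b (Y b) = 0 := fun b => by rw [← S.g_ξ_right, hYξ]
  have hφX := S.isSmoothField_φField hX
  have hφY := S.isSmoothField_φField hY
  rw [curvature, K.covDeriv_lift_vert hX, K.covDeriv_lift_vert hY, K.bracket_lift hX hY,
    covDeriv_add_left, covDeriv_smul_left, K.covDeriv_vert_vert,
    K.covDeriv_lift_vert (hX.bracket hY), K.covDeriv_lift_lift hX hφY, K.covDeriv_lift_lift hY hφX]
  have h0 : covDeriv nabla X (S.φField Y) - covDeriv nabla Y (S.φField X) -
      S.φField (bracket X Y) = 0 := by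
    funext b
    have h1 : covDeriv nabla X (S.φField Y) b - _ = _ := K.sasakian.nabla_φ X Y hX hY b
    have h2 : covDeriv nabla Y (S.φField X) b - _ = _ := K.sasakian.nabla_φ Y X hY hX b
    rw [hηY, zero_smul, sub_zero, sub_eq_iff_eq_add] at h1
    rw [hηX, zero_smul, sub_zero, sub_eq_iff_eq_add, S.isSymmBilin_g.symm] at h2
    have h3 : S.φField (bracket X Y) b =
        S.φ b (covDeriv nabla X Y b) - S.φ b (covDeriv nabla Y X b) := by
      rw [← K.base.covDeriv_sub_covDeriv hX hY, ← map_sub]; rfl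
    simp only [Pi.sub_apply, Pi.zero_apply]
    rw [h1, h2, h3]
    abel
  have h1 := congrArg A.lift h0
  rw [A.lift_sub, A.lift_sub, A.lift_zero] at h1
  funext p
  have h2 := congrFun h1 p
  simp only [Pi.sub_apply, Pi.add_apply, Pi.smul_apply', Pi.zero_apply, smul_zero,
    S.isSymmBilin_g.symm (π.proj p) (S.φField Y (π.proj p))] at h2 ⊢
  refine Eq.trans ?_ h2
  abel

/-- The `ξ̂` part comes from the formula for `∇φ` and the `v` part from `g(φX, φY)`. On `𝒟` both
coefficients equal `g(X, Y)`. -/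
theorem curvature_lift_vert_lift {X Y : VField m B} (hX : IsSmoothField X)
    (hY : IsSmoothField Y) (hXξ : ∀ b, S.g b (X b) (S.ξ b) = 0)
    (hYξ : ∀ b, S.g b (Y b) (S.ξ b) = 0) :
    curvature D (A.lift X) π.vert (A.lift Y) =
      fun p => S.g (π.proj p) (X (π.proj p)) (Y (π.proj p)) • (A.lift S.ξ + π.vert) p := by
  have hηX : ∀ b, S.η.toFun b (X b) = 0 := fun b => by rw [← S.g_ξ_right, hXξ]
  have hηY : ∀ b, S.η.toFun b (Y b) = 0 := fun b => by rw [← S.g_ξ_right, hYξ]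
  have hφX := S.isSmoothField_φField hX
  have hφY := S.isSmoothField_φField hY
  have hXY := hX.covDeriv K.base.smooth hY
  have hv := π.isSmoothField_vert
  have hf := S.contMDiff_g_fields hφX hY
  have hfπ : ContMDiff (𝓡 (m + 1)) 𝓘(ℝ, ℝ) ∞
      (fun p => S.g (π.proj p) (S.φField X (π.proj p)) (Y (π.proj p))) := hf.comp π.proj_smooth
  have h0 : covDeriv D (0 : VField (m + 1) P) (A.lift Y) = 0 := by
    funext p; simp [covDeriv]
  rw [curvature, K.covDeriv_vert_lift_eq hY, A.bracket_lift_vert hX, h0,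
    K.covDeriv_lift_lift hX hφY, K.covDeriv_lift_lift hX hY,
    covDeriv_add _ (A.isSmoothField_lift hXY) (hv.smul hfπ), covDeriv_smul _ hfπ hv,
    K.covDeriv_vert_vert, K.covDeriv_vert_lift_eq hXY]
  have h1 : covDeriv nabla X (S.φField Y) =
      S.φField (covDeriv nabla X Y) + (fun b => S.g b (X b) (Y b)) • S.ξ := by
    funext b
    have h1 : covDeriv nabla X (S.φField Y) b - _ = _ := K.sasakian.nabla_φ X Y hX hY b
    rw [hηY, zero_smul, sub_zero, sub_eq_iff_eq_add'] at h1
    exact h1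
  rw [h1, A.lift_add, A.lift_smul]
  funext p
  have h2 : S.g (π.proj p) (S.φField X (π.proj p)) (S.φField Y (π.proj p)) =
      S.g (π.proj p) (X (π.proj p)) (Y (π.proj p)) := by
    simp only [AlmostContactMetric.φField, S.g_φ_φ, hηX, zero_mul, sub_zero]
  simp only [Pi.add_apply, Pi.sub_apply, Pi.smul_apply', Pi.zero_apply, h2,
    mvfderiv_proj_vert hf]
  module

theorem curvature_lift_vert_vert {X : VField m B} (hX : IsSmoothField X)
    (hXξ : ∀ b, S.g b (X b) (S.ξ b) = 0) :
    curvature D (A.lift X) π.vert π.vert = A.lift X := by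
  have h0 : covDeriv D (0 : VField (m + 1) P) π.vert = 0 := by
    funext p; simp [covDeriv]
  have hφφ : S.φField (S.φField X) = -X := by
    funext b
    simp only [AlmostContactMetric.φField, S.φ_φ, ← S.g_ξ_right, hXξ, zero_smul, add_zero,
      Pi.neg_apply]
  rw [curvature, A.bracket_lift_vert hX, h0, K.covDeriv_vert_vert, covDeriv_zero,
    K.covDeriv_lift_vert hX, K.covDeriv_vert_lift_eq (S.isSmoothField_φField hX), hφφ, A.lift_neg]
  simp

/-- Since `r̃ = r - 2v` with `r` parallel, the curvature on `r̃` is `-2` times that on `v`. -/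
theorem curvature_reeb_sub_vert {U V : VField (m + 1) P} (hU : IsSmoothField U)
    (hV : IsSmoothField V) :
    curvature D U V (A.lift S.ξ - π.vert) = (-2 : ℝ) • curvature D U V π.vert := by
  have hv := π.isSmoothField_vert
  have h1 : A.lift S.ξ - π.vert = (A.lift S.ξ + π.vert) + (-2 : ℝ) • π.vert := by module
  have h2 : ∀ W, covDeriv D W (A.lift S.ξ - π.vert) = (-2 : ℝ) • covDeriv D W π.vert := by
    intro W
    rw [h1, covDeriv_add W (isSmoothField_reeb_add_vert S A) (hv.const_smul _),
      K.covDeriv_reeb_add_vert, zero_add, covDeriv_const_smul W _ hv]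
  rw [curvature, h2, h2, h2, covDeriv_const_smul _ _ (hV.covDeriv K.total.smooth hv),
    covDeriv_const_smul _ _ (hU.covDeriv K.total.smooth hv), curvature]
  module

end IsSasakianKK

end KaluzaKlein

theorem mainTheorem7 {n : ℕ} {B P : Type*}
    [TopologicalSpace B] [T2Space B] [SecondCountableTopology B]
    [ChartedSpace (EuclideanSpace ℝ (Fin (2 * n + 1))) B] [IsManifold (𝓡 (2 * n + 1)) ∞ B]
    [TopologicalSpace P] [T2Space P] [SecondCountableTopology P]
    [ChartedSpace (EuclideanSpace ℝ (Fin (2 * n + 1 + 1))) P]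
    [IsManifold (𝓡 (2 * n + 1 + 1)) ∞ P] [MulAction Circle P]
    (S : KaluzaKlein.AlmostContactMetric (2 * n + 1) B)
    (nabla : KaluzaKlein.TangentConnection (2 * n + 1) B)
    (hnabla : KaluzaKlein.IsLeviCivita S.g nabla)
    (hS : S.IsSasakian nabla)
    (π : KaluzaKlein.PrincipalCircleBundle (2 * n + 1) B P)
    (A₀ : π.ConnectionForm) (hA₀ : A₀.IsFlat)
    (D : KaluzaKlein.TangentConnection (2 * n + 1 + 1) P)
    (hD : KaluzaKlein.IsLeviCivita ((A₀.addPullback S.η).kkMetric S.g 1) D) :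
    let A : π.ConnectionForm := A₀.addPullback S.η
    let v : KaluzaKlein.VField (2 * n + 1 + 1) P := π.vert
    let r : KaluzaKlein.VField (2 * n + 1 + 1) P := A.lift S.ξ + v
    let r' : KaluzaKlein.VField (2 * n + 1 + 1) P := A.lift S.ξ - v
    (∀ U V : KaluzaKlein.VField (2 * n + 1 + 1) P,
      KaluzaKlein.IsSmoothField U → KaluzaKlein.IsSmoothField V →
        KaluzaKlein.curvature D U V r = 0) ∧
    (∀ U W : KaluzaKlein.VField (2 * n + 1 + 1) P,
      KaluzaKlein.IsSmoothField U → KaluzaKlein.IsSmoothField W →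
        KaluzaKlein.curvature D r U W = 0) ∧
    (∀ X Y Z : KaluzaKlein.VField (2 * n + 1) B,
      KaluzaKlein.IsSmoothField X → KaluzaKlein.IsSmoothField Y →
      KaluzaKlein.IsSmoothField Z →
      (∀ b, S.g b (X b) (S.ξ b) = 0) → (∀ b, S.g b (Y b) (S.ξ b) = 0) →
      (∀ b, S.g b (Z b) (S.ξ b) = 0) →
        KaluzaKlein.curvature D (A.lift X) (A.lift Y) (A.lift Z) =
          A.lift (KaluzaKlein.transverseCurvature S.g nabla S.ξ X Y Z) ∧
        KaluzaKlein.curvature D (A.lift X) (A.lift Y) r' = 0 ∧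
        KaluzaKlein.curvature D (A.lift X) v (A.lift Y) =
          (fun p => S.g (π.proj p) (X (π.proj p)) (Y (π.proj p)) • r p) ∧
        KaluzaKlein.curvature D (A.lift X) v r' = (-2 : ℝ) • A.lift X) := by
  intro A v r r'
  have K : KaluzaKlein.IsSasakianKK S nabla A D := by
    refine ⟨hnabla, hS, hD, fun X Y hX hY p => ?_⟩
    -- The bracket formula involves `2 dη`, because `d` carries a factor `1/2`; the contact
    -- condition turns `-2 dη(X, Y)` into `2 g(φX, Y)`.
    rw [A₀.im_bracket_lift_addPullback S.η hA₀ hX hY, hS.two_dη hX hY]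
    ring
  have hr : KaluzaKlein.IsSmoothField r :=
    KaluzaKlein.IsSasakianKK.isSmoothField_reeb_add_vert S A
  have hrD : ∀ U, KaluzaKlein.covDeriv D U r = 0 := K.covDeriv_reeb_add_vert
  have hv : KaluzaKlein.IsSmoothField v := π.isSmoothField_vert
  refine ⟨fun U V _ _ => KaluzaKlein.IsLeviCivita.curvature_parallel hrD U V,
    fun U W hU hW => hD.curvature_parallel_left (A.isSymmBilin_kkMetric S)
      (fun _ _ => A.contMDiff_kkMetric S) (A.kkMetric_nondegenerate S) hr hrD hU hW,
    fun X Y Z hX hY hZ hXξ hYξ hZξ => ⟨?_, ?_, ?_, ?_⟩⟩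
  · exact K.curvature_lift_lift_lift hX hY hZ hXξ hYξ hZξ
  · refine (K.curvature_reeb_sub_vert (A.isSmoothField_lift hX) (A.isSmoothField_lift hY)).trans ?_
    rw [K.curvature_lift_lift_vert hX hY hXξ hYξ, smul_zero]
  · exact K.curvature_lift_vert_lift hX hY hXξ hYξ
  · refine (K.curvature_reeb_sub_vert (A.isSmoothField_lift hX) hv).trans ?_
    rw [K.curvature_lift_vert_vert hX hXξ]
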